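/- Let $\lambda\ge 0$. For an integer $k\ge 1$ put $$Q_{\lambda,k}(r)=2\arctan\bigl(\lambda^k\tanh^k(r/2)\bigr),\qquad V_{\lambda,k}(r)=k^2\,\frac{\cos(2Q_{\lambda,k}(r))-1}{\sinh^2 r},$$ and put $$Q_{\mathrm{YM},\lambda}(r)=\frac{2\lambda^2\tanh^2(r/2)}{1+\lambda^2\tanh^2(r/2)},\qquad W_\lambda(r)=\frac{6\,Q_{\mathrm{YM},\lambda}(r)\,(Q_{\mathrm{YM},\lambda}(r)-2)}{\sinh^2 r}.$$ Let $\mathcal V=V_{\lambda,k}$ for some integer $k\ge1$, or $\mathcal V=W_\lambda$ with $k=2$. Consider in the complex Hilbert space $L^2(0,\infty)$ the unbounded operator $$\mathcal L_{\mathcal V}=-\partial_{rr}+\frac14+\frac{k^2-\frac14}{\sinh^2 r}+\mathcal V(r),$$ whose domain consists of the functions $\sinh^{k+\frac12}(r)\,u(r)$ with $u$ a radial function in the Sobolev space $H^2(\mathbb H^{2k+2})$ ($r$ is the geodesic distance to a fixed point of hyperbolic space). Then: (i) $\sigma(\mathcal L_{\mathcal V})\cap(-\infty,0]=\emptyset$.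 (ii) $\mathcal L_{\mathcal V}$ has no eigenvalue in $[\tfrac14,\infty)$. Hence every eigenvalue of $\mathcal L_{\mathcal V}$ is real and lies in the gap $(0,\tfrac14)$. -/

import Mathlib

open MeasureTheory Set Filter Topology

noncomputable section

namespace HypGap

/-! ### The stationary solutions and the linearized potentials -/

/-- The `k`-equivariant harmonic map `ℍ² → 𝕊²`:
`Q_{λ,k}(r) = 2 arctan (λ^k tanh^k (r/2))`. -/
def harmonicMap (k : ℕ) (lam r : ℝ) : ℝ :=
  2 * Real.arctan (lam ^ k * Real.tanh (r / 2) ^ k)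

/-- `V_{λ,k}(r) = k² (cos (2 Q_{λ,k}(r)) - 1) / sinh² r`. -/
def potentialV (k : ℕ) (lam r : ℝ) : ℝ :=
  (k : ℝ) ^ 2 * (Real.cos (2 * harmonicMap k lam r) - 1) / Real.sinh r ^ 2

/-- The Yang-Mills stationary solution
`Q_{YM,λ}(r) = 2 λ² tanh² (r/2) / (1 + λ² tanh² (r/2))`. -/
def yangMillsMap (lam r : ℝ) : ℝ :=
  2 * lam ^ 2 * Real.tanh (r / 2) ^ 2 / (1 + lam ^ 2 * Real.tanh (r / 2) ^ 2)

/-- `W_λ(r) = 6 Q_{YM,λ}(r) (Q_{YM,λ}(r) - 2) / sinh² r`. -/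
def potentialW (lam r : ℝ) : ℝ :=
  6 * yangMillsMap lam r * (yangMillsMap lam r - 2) / Real.sinh r ^ 2

/-! ### The Hilbert space and the domain -/

/-- Lebesgue measure on `(0, ∞)`. -/
abbrev halfLine : Measure ℝ := volume.restrict (Ioi (0 : ℝ))

/-- The complex Hilbert space `L²(0, ∞)`. -/
abbrev HalfLineL2 : Type := Lp ℂ 2 halfLine

/-- The conjugating factor `sinh^{k + 1/2} r`. -/
def weight (k : ℕ) (r : ℝ) : ℝ := Real.sinh r ^ ((k : ℝ) + 1 / 2)

/-- `u(r)`, read as a radial function on `ℍ^{2k+2}` in geodesic polar coordinates, is in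
`L²(ℍ^{2k+2})`, whose volume element is `sinh^{2k+1} r dr dω`: that is,
`∫₀^∞ |u(r)|² sinh^{2k+1} r dr < ∞`, or equivalently `sinh^{k+1/2} r · u ∈ L²(0, ∞)`. -/
def RadialL2 (k : ℕ) (u : ℝ → ℂ) : Prop :=
  MemLp (fun r => (weight k r : ℂ) * u r) 2 halfLine

/-- `u(r)`, read as a radial function on `ℍ^{2k+2}`, is in the Sobolev space `H²(ℍ^{2k+2})`: it has
two weak derivatives (`u` is differentiable with locally absolutely continuous derivative on
`(0, ∞)`), and `u`, its gradient and its Hessian are in `L²`. In geodesic polar coordinates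
`|∇u|² = |u'|²` and `|∇²u|² = |u''|² + (2k+1) |coth r · u'|²`. -/
structure IsRadialH2 (k : ℕ) (u : ℝ → ℂ) : Prop where
  differentiableAt : ∀ r : ℝ, 0 < r → DifferentiableAt ℝ u r
  absolutelyContinuous : ∀ a b : ℝ, 0 < a → a ≤ b → AbsolutelyContinuousOnInterval (deriv u) a b
  radialL2 : RadialL2 k u
  radialL2_deriv : RadialL2 k (deriv u)
  radialL2_deriv_deriv : RadialL2 k (deriv (deriv u))
  radialL2_coth_deriv :
    RadialL2 k (fun r => ((Real.cosh r / Real.sinh r : ℝ) : ℂ) * deriv u r)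

/-- The differential expression
`𝓛_V φ = - φ'' + (1/4 + (k² - 1/4) / sinh² r + V(r)) φ`. -/
def halfLineExpr (k : ℕ) (V : ℝ → ℝ) (φ : ℝ → ℂ) (r : ℝ) : ℂ :=
  - deriv (deriv φ) r
    + ((1 / 4 + ((k : ℝ) ^ 2 - 1 / 4) / Real.sinh r ^ 2 + V r : ℝ) : ℂ) * φ r

/-- The map `u ↦ sinh^{k+1/2} r · u`. -/
def conj (k : ℕ) (u : ℝ → ℂ) (r : ℝ) : ℂ := (weight k r : ℂ) * u r

/-! ### The expression `𝓛_V` maps the domain into `L²` and is linear -/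

lemma weight_pos (k : ℕ) {r : ℝ} (hr : 0 < r) : 0 < weight k r :=
  Real.rpow_pos_of_pos (Real.sinh_pos_iff.mpr hr) _

lemma hasDerivAt_weight (k : ℕ) {r : ℝ} (hr : 0 < r) :
    HasDerivAt (weight k)
      (((k : ℝ) + 1 / 2) * (Real.cosh r / Real.sinh r) * weight k r) r := by
  have hs : 0 < Real.sinh r := Real.sinh_pos_iff.mpr hr
  have h := (Real.hasDerivAt_sinh r).rpow_const (p := (k : ℝ) + 1 / 2) (Or.inl hs.ne')
  refine h.congr_deriv ?_
  rw [Real.rpow_sub_one hs.ne', weight]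
  field_simp

lemma hasDerivAt_coth {r : ℝ} (hr : 0 < r) :
    HasDerivAt (fun r => Real.cosh r / Real.sinh r) (-(1 / Real.sinh r ^ 2)) r := by
  have hs : 0 < Real.sinh r := Real.sinh_pos_iff.mpr hr
  refine ((Real.hasDerivAt_cosh r).div (Real.hasDerivAt_sinh r) hs.ne').congr_deriv ?_
  have := Real.cosh_sq r
  field_simp
  linarith

lemma deriv_conj (k : ℕ) {u : ℝ → ℂ} {r : ℝ} (hr : 0 < r) (hu : DifferentiableAt ℝ u r) :
    deriv (conj k u) r =
      (weight k r : ℂ) *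
        ((((k : ℝ) + 1 / 2) * (Real.cosh r / Real.sinh r) : ℝ) * u r + deriv u r) := by
  have h1 := (hasDerivAt_weight k hr).ofReal_comp.mul hu.hasDerivAt
  have h2 : deriv (conj k u) r = _ := h1.deriv
  rw [h2]
  push_cast
  ring

lemma ae_differentiableAt_deriv {k : ℕ} {u : ℝ → ℂ} (hu : IsRadialH2 k u) :
    ∀ᵐ r ∂halfLine, DifferentiableAt ℝ (deriv u) r := by
  rw [ae_restrict_iff' measurableSet_Ioi]
  have h : ∀ n : ℕ, ∀ᵐ r : ℝ, r ∈ uIcc (1 / ((n : ℝ) + 1)) ((n : ℝ) + 1) →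
      DifferentiableAt ℝ (deriv u) r := fun n => by
    refine (hu.absolutelyContinuous _ _ (by positivity)
      ?_).boundedVariationOn.ae_differentiableAt_of_mem_uIcc
    rw [div_le_iff₀ (by positivity)]
    have : (0 : ℝ) ≤ n := n.cast_nonneg
    nlinarith
  filter_upwards [ae_all_iff.mpr h] with r hr hr0
  have hr0' : 0 < r := hr0
  obtain ⟨n, hn⟩ := exists_nat_ge (max r (1 / r))
  have h1 : r ≤ n := (le_max_left _ _).trans hn
  have h2 : 1 / r ≤ n := (le_max_right _ _).trans hn
  apply hr n
  rw [div_le_iff₀ hr0'] at h2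
  apply Icc_subset_uIcc
  refine ⟨?_, by linarith⟩
  rw [div_le_iff₀ (by positivity)]
  nlinarith

/-- The conjugation identity `𝓛_V (sinh^{k+1/2} u) = sinh^{k+1/2} H_V u`, where
`H_V u = - u'' - (2k+1) coth r u' - k(k+1) u + V u`. -/
lemma halfLineExpr_conj (k : ℕ) (V : ℝ → ℝ) {u : ℝ → ℂ}
    (hd : ∀ r : ℝ, 0 < r → DifferentiableAt ℝ u r) {r : ℝ} (hr : 0 < r)
    (hdd : DifferentiableAt ℝ (deriv u) r) :
    halfLineExpr k V (conj k u) r =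
      (weight k r : ℂ) * (- deriv (deriv u) r
        - (2 * k + 1) * (((Real.cosh r / Real.sinh r : ℝ) : ℂ) * deriv u r)
        - k * (k + 1) * u r + (V r : ℂ) * u r) := by
  have hs : 0 < Real.sinh r := Real.sinh_pos_iff.mpr hr
  have hev : deriv (conj k u) =ᶠ[𝓝 r] fun x => (weight k x : ℂ) *
      ((((k : ℝ) + 1 / 2) * (Real.cosh x / Real.sinh x) : ℝ) * u x + deriv u x) := by
    filter_upwards [Ioi_mem_nhds hr] with x hx
    exact deriv_conj k hx (hd x hx)
  have h2 := (hasDerivAt_weight k hr).ofReal_comp.mul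
    ((((hasDerivAt_coth hr).const_mul ((k : ℝ) + 1 / 2)).ofReal_comp.mul
      (hd r hr).hasDerivAt).add hdd.hasDerivAt)
  have h3 : deriv (deriv (conj k u)) r = _ := hev.deriv_eq.trans h2.deriv
  have hc : ((Real.cosh r / Real.sinh r : ℝ) : ℂ) ^ 2 = 1 + ((1 / Real.sinh r ^ 2 : ℝ) : ℂ) := by
    rw [← Complex.ofReal_pow, ← Complex.ofReal_one, ← Complex.ofReal_add, Complex.ofReal_inj,
      div_pow, Real.cosh_sq r]
    field_simp
  rw [halfLineExpr, h3, conj]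
  have e : ((1 / 4 + ((k : ℝ) ^ 2 - 1 / 4) / Real.sinh r ^ 2 + V r : ℝ) : ℂ)
      = 1 / 4 + ((k : ℂ) ^ 2 - 1 / 4) * ((1 / Real.sinh r ^ 2 : ℝ) : ℂ) + (V r : ℂ) := by
    push_cast
    ring
  rw [e]
  simp only [Pi.add_apply, Pi.mul_apply, Complex.ofReal_mul, Complex.ofReal_neg, Complex.ofReal_add]
  generalize ((Real.cosh r / Real.sinh r : ℝ) : ℂ) = c at *
  generalize ((1 / Real.sinh r ^ 2 : ℝ) : ℂ) = d at *
  obtain rfl : d = c ^ 2 - 1 := by rw [hc]; ring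
  push_cast
  ring

lemma IsRadialH2.ae_halfLineExpr {k : ℕ} {u : ℝ → ℂ} (hu : IsRadialH2 k u) (V : ℝ → ℝ) :
    halfLineExpr k V (conj k u) =ᵐ[halfLine] fun r =>
      (weight k r : ℂ) * (- deriv (deriv u) r
        - (2 * k + 1) * (((Real.cosh r / Real.sinh r : ℝ) : ℂ) * deriv u r)
        - k * (k + 1) * u r + (V r : ℂ) * u r) := by
  filter_upwards [ae_differentiableAt_deriv hu, ae_restrict_mem measurableSet_Ioi] with r h hr
  exact halfLineExpr_conj k V hu.differentiableAt hr h

lemma IsRadialH2.memLp_halfLineExpr {k : ℕ} {u : ℝ → ℂ} (hu : IsRadialH2 k u) {V : ℝ → ℝ}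
    (hV : MemLp V ⊤ halfLine) : MemLp (halfLineExpr k V (conj k u)) 2 halfLine := by
  rw [memLp_congr_ae (hu.ae_halfLineExpr V)]
  have h1 := hu.radialL2_deriv_deriv.neg
  have h2 := hu.radialL2_coth_deriv.const_mul (2 * k + 1 : ℂ)
  have h3 := hu.radialL2.const_mul (k * (k + 1) : ℂ)
  have h4 : MemLp (fun r => (V r : ℂ) * ((weight k r : ℂ) * u r)) 2 halfLine :=
    MemLp.mul (p := ⊤) (q := 2) hu.radialL2 hV.ofReal
  refine (((h1.sub h2).sub h3).add h4).ae_eq (Eventually.of_forall fun r => ?_)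
  simp only [Pi.add_apply, Pi.sub_apply, Pi.neg_apply]
  ring

lemma absolutelyContinuous_congr {f g : ℝ → ℂ} {a b : ℝ} (ha : 0 < a) (hab : a ≤ b)
    (h : ∀ r, 0 < r → f r = g r) (hf : AbsolutelyContinuousOnInterval f a b) :
    AbsolutelyContinuousOnInterval g a b := by
  rw [absolutelyContinuousOnInterval_iff] at hf ⊢
  intro ε hε
  obtain ⟨δ, hδ, H⟩ := hf ε hε
  refine ⟨δ, hδ, fun E hE hlt => ?_⟩
  have hpos : ∀ x ∈ uIcc a b, f x = g x := fun x hx => by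
    rw [uIcc_of_le hab] at hx
    exact h x (ha.trans_le hx.1)
  refine lt_of_eq_of_lt (Finset.sum_congr rfl fun i hi => ?_) (H E hE hlt)
  rw [hpos _ (hE.1 i (by simpa using hi)).1,
    hpos _ (hE.1 i (by simpa using hi)).2]

lemma IsRadialH2.add {k : ℕ} {u v : ℝ → ℂ} (hu : IsRadialH2 k u) (hv : IsRadialH2 k v) :
    IsRadialH2 k (u + v) := by
  have hd : ∀ r : ℝ, 0 < r → deriv (u + v) r = deriv u r + deriv v r := fun r hr =>
    deriv_add (hu.differentiableAt r hr) (hv.differentiableAt r hr)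
  have hmem := ae_restrict_mem (μ := volume) (measurableSet_Ioi (a := (0 : ℝ)))
  refine ⟨fun r hr => (hu.differentiableAt r hr).add (hv.differentiableAt r hr),
    fun a b ha hab => ?_, ?_, ?_, ?_, ?_⟩
  · exact absolutelyContinuous_congr ha hab (fun r hr => (hd r hr).symm)
      ((hu.absolutelyContinuous a b ha hab).add (hv.absolutelyContinuous a b ha hab))
  · refine (MemLp.add hu.radialL2 hv.radialL2).ae_eq (Eventually.of_forall fun r => ?_)
    simp [mul_add]
  · refine (MemLp.add hu.radialL2_deriv hv.radialL2_deriv).ae_eq ?_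
    filter_upwards [hmem] with r hr
    simp [mul_add, hd r hr]
  · refine (MemLp.add hu.radialL2_deriv_deriv hv.radialL2_deriv_deriv).ae_eq ?_
    filter_upwards [hmem, ae_differentiableAt_deriv hu, ae_differentiableAt_deriv hv]
      with r hr h1 h2
    have : deriv (deriv (u + v)) r = deriv (deriv u) r + deriv (deriv v) r := by
      rw [← deriv_add h1 h2]
      apply Filter.EventuallyEq.deriv_eq
      filter_upwards [Ioi_mem_nhds hr] with x hx using hd x hx
    simp [mul_add, this]
  · refine (MemLp.add hu.radialL2_coth_deriv hv.radialL2_coth_deriv).ae_eq ?_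
    filter_upwards [hmem] with r hr
    simp [mul_add, hd r hr]

lemma IsRadialH2.const_smul {k : ℕ} {u : ℝ → ℂ} (c : ℂ) (hu : IsRadialH2 k u) :
    IsRadialH2 k (c • u) := by
  have hd : deriv (c • u) = c • deriv u := by
    funext r
    exact deriv_const_smul_field c u
  have hdd : deriv (deriv (c • u)) = c • deriv (deriv u) := by
    rw [hd]
    funext r
    exact deriv_const_smul_field c (deriv u)
  refine ⟨fun r hr => (hu.differentiableAt r hr).const_smul c, fun a b ha hab => ?_, ?_, ?_, ?_, ?_⟩
  · rw [hd]
    exact (hu.absolutelyContinuous a b ha hab).const_smul c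
  · refine (MemLp.const_smul hu.radialL2 c).ae_eq (Eventually.of_forall fun r => ?_)
    simp [mul_left_comm]
  · rw [hd]
    refine (MemLp.const_smul hu.radialL2_deriv c).ae_eq (Eventually.of_forall fun r => ?_)
    simp [mul_left_comm]
  · rw [hdd]
    refine (MemLp.const_smul hu.radialL2_deriv_deriv c).ae_eq (Eventually.of_forall fun r => ?_)
    simp [mul_left_comm]
  · rw [hd]
    refine (MemLp.const_smul hu.radialL2_coth_deriv c).ae_eq (Eventually.of_forall fun r => ?_)
    simp [mul_left_comm]

lemma isRadialH2_zero (k : ℕ) : IsRadialH2 k 0 := by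
  have hd : deriv (0 : ℝ → ℂ) = 0 := by
    funext r
    simp
  have h0 : RadialL2 k 0 := by
    simp [RadialL2]
  refine ⟨fun r _ => differentiableAt_const 0, fun a b _ _ => ?_, h0, ?_, ?_, ?_⟩
  · rw [hd, absolutelyContinuousOnInterval_iff]
    intro ε hε
    exact ⟨1, one_pos, fun E _ _ => by simpa using hε⟩
  · rwa [hd]
  · rwa [hd, hd]
  · simp [hd, RadialL2]

/-- Two elements of `H²` whose images under the conjugation agree almost everywhere agree
on `(0, ∞)`. -/
lemma IsRadialH2.eq_of_ae_eq {k : ℕ} {u v : ℝ → ℂ} (hu : IsRadialH2 k u) (hv : IsRadialH2 k v)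
    (h : conj k u =ᵐ[halfLine] conj k v) : ∀ r : ℝ, 0 < r → u r = v r := by
  have h' : u =ᵐ[halfLine] v := by
    filter_upwards [h, ae_restrict_mem measurableSet_Ioi] with r hr hr0
    exact mul_left_cancel₀ (Complex.ofReal_ne_zero.mpr (weight_pos k hr0).ne') hr
  have hcu : ContinuousOn u (Ioi 0) := fun r hr =>
    (hu.differentiableAt r hr).continuousAt.continuousWithinAt
  have hcv : ContinuousOn v (Ioi 0) := fun r hr =>
    (hv.differentiableAt r hr).continuousAt.continuousWithinAt
  exact fun r hr => Measure.eqOn_open_of_ae_eq h' isOpen_Ioi hcu hcv hr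

lemma IsRadialH2.halfLineExpr_congr {k : ℕ} {u v : ℝ → ℂ} (hu : IsRadialH2 k u)
    (hv : IsRadialH2 k v) (V : ℝ → ℝ) (h : conj k u =ᵐ[halfLine] conj k v) :
    halfLineExpr k V (conj k u) =ᵐ[halfLine] halfLineExpr k V (conj k v) := by
  have he : ∀ r : ℝ, 0 < r → conj k u r = conj k v r := fun r hr => by
    rw [conj, conj, hu.eq_of_ae_eq hv h r hr]
  have hd : ∀ r : ℝ, 0 < r → deriv (conj k u) r = deriv (conj k v) r := fun r hr => by
    apply Filter.EventuallyEq.deriv_eq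
    filter_upwards [Ioi_mem_nhds hr] with x hx using he x hx
  filter_upwards [ae_restrict_mem measurableSet_Ioi] with r hr
  have hdd : deriv (deriv (conj k u)) r = deriv (deriv (conj k v)) r := by
    apply Filter.EventuallyEq.deriv_eq
    filter_upwards [Ioi_mem_nhds hr] with x hx using hd x hx
  rw [halfLineExpr, halfLineExpr, hdd, he r hr]

lemma IsRadialH2.halfLineExpr_add {k : ℕ} {u v : ℝ → ℂ} (hu : IsRadialH2 k u)
    (hv : IsRadialH2 k v) (V : ℝ → ℝ) :
    halfLineExpr k V (conj k (u + v)) =ᵐ[halfLine]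
      halfLineExpr k V (conj k u) + halfLineExpr k V (conj k v) := by
  filter_upwards [(hu.add hv).ae_halfLineExpr V, hu.ae_halfLineExpr V, hv.ae_halfLineExpr V,
    ae_restrict_mem measurableSet_Ioi, ae_differentiableAt_deriv hu,
    ae_differentiableAt_deriv hv] with r h h1 h2 hr hd1 hd2
  have hd : ∀ x : ℝ, 0 < x → deriv (u + v) x = deriv u x + deriv v x := fun x hx =>
    deriv_add (hu.differentiableAt x hx) (hv.differentiableAt x hx)
  have hdd : deriv (deriv (u + v)) r = deriv (deriv u) r + deriv (deriv v) r := by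
    rw [← deriv_add hd1 hd2]
    apply Filter.EventuallyEq.deriv_eq
    filter_upwards [Ioi_mem_nhds hr] with x hx using hd x hx
  rw [Pi.add_apply, h, h1, h2, hdd, hd r hr, Pi.add_apply]
  ring

lemma halfLineExpr_smul (k : ℕ) (u : ℝ → ℂ) (c : ℂ) (V : ℝ → ℝ) :
    halfLineExpr k V (conj k (c • u)) = c • halfLineExpr k V (conj k u) := by
  have h : conj k (c • u) = c • conj k u := by
    funext r
    simp [conj, mul_left_comm]
  have hd : ∀ w : ℝ → ℂ, deriv (c • w) = c • deriv w := fun w => by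
    funext r
    exact deriv_const_smul_field c w
  funext r
  rw [h, halfLineExpr, hd, hd]
  simp only [Pi.smul_apply, smul_eq_mul, halfLineExpr]
  ring

/-! ### The operator `𝓛_V` -/

/-- The domain of `𝓛_V`: the image of the radial functions in `H²(ℍ^{2k+2})` under
`u ↦ sinh^{k+1/2} r · u`, as a subspace of `L²(0, ∞)`. -/
def domain (k : ℕ) : Submodule ℂ HalfLineL2 where
  carrier := {f | ∃ u : ℝ → ℂ, IsRadialH2 k u ∧ f =ᵐ[halfLine] conj k u}
  add_mem' := by
    rintro f g ⟨u, hu, hfu⟩ ⟨v, hv, hgv⟩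
    refine ⟨u + v, hu.add hv, ?_⟩
    filter_upwards [Lp.coeFn_add f g, hfu, hgv] with r h h1 h2
    rw [h, Pi.add_apply, h1, h2, conj, conj, conj, Pi.add_apply, mul_add]
  zero_mem' := by
    refine ⟨0, isRadialH2_zero k, ?_⟩
    filter_upwards [Lp.coeFn_zero ℂ 2 halfLine] with r h
    rw [h]
    simp [conj]
  smul_mem' := by
    rintro c f ⟨u, hu, hfu⟩
    refine ⟨c • u, hu.const_smul c, ?_⟩
    filter_upwards [Lp.coeFn_smul c f, hfu] with r h h1
    rw [h, Pi.smul_apply, h1]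
    simp [conj, mul_left_comm]

/-- The radial `H²` function representing an element of the domain. -/
def domainRep (k : ℕ) (f : domain k) : ℝ → ℂ := f.2.choose

lemma domainRep_isRadialH2 (k : ℕ) (f : domain k) : IsRadialH2 k (domainRep k f) :=
  f.2.choose_spec.1

lemma domainRep_ae_eq (k : ℕ) (f : domain k) :
    (f : HalfLineL2) =ᵐ[halfLine] conj k (domainRep k f) :=
  f.2.choose_spec.2

/-- For `V ∈ L^∞(0, ∞)`, the unbounded operator
`𝓛_V = - ∂_rr + 1/4 + (k² - 1/4) / sinh² r + V(r)` on `L²(0, ∞)` with domain `domain k`. -/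
def schrodinger (k : ℕ) (V : ℝ → ℝ) (hV : MemLp V ⊤ halfLine) :
    HalfLineL2 →ₗ.[ℂ] HalfLineL2 where
  domain := domain k
  toFun :=
    { toFun := fun f => ((domainRep_isRadialH2 k f).memLp_halfLineExpr hV).toLp
        (halfLineExpr k V (conj k (domainRep k f)))
      map_add' := fun f g => by
        have hf := domainRep_isRadialH2 k f
        have hg := domainRep_isRadialH2 k g
        rw [← MemLp.toLp_add, MemLp.toLp_eq_toLp_iff]
        refine ((domainRep_isRadialH2 k (f + g)).halfLineExpr_congr (hf.add hg) V ?_).trans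
          (hf.halfLineExpr_add hg V)
        filter_upwards [domainRep_ae_eq k (f + g), domainRep_ae_eq k f, domainRep_ae_eq k g,
          Lp.coeFn_add (f : HalfLineL2) (g : HalfLineL2)] with r h h1 h2 h3
        rw [← h, Submodule.coe_add, h3, Pi.add_apply, h1, h2, conj, conj, conj, Pi.add_apply,
          mul_add]
      map_smul' := fun c f => by
        have hf := domainRep_isRadialH2 k f
        rw [RingHom.id_apply, ← MemLp.toLp_const_smul, MemLp.toLp_eq_toLp_iff]
        rw [← halfLineExpr_smul]
        refine (domainRep_isRadialH2 k (c • f)).halfLineExpr_congr (hf.const_smul c) V ?_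
        filter_upwards [domainRep_ae_eq k (c • f), domainRep_ae_eq k f,
          Lp.coeFn_smul c (f : HalfLineL2)] with r h h1 h2
        rw [← h, Submodule.coe_smul, h2, Pi.smul_apply, h1]
        simp [conj, mul_left_comm] }

/-- The value of `𝓛_V` may be computed from any radial `H²` function `u` that represents the
argument. -/
lemma schrodinger_ae_eq {k : ℕ} {V : ℝ → ℝ} (hV : MemLp V ⊤ halfLine) {u : ℝ → ℂ}
    (hu : IsRadialH2 k u) (f : (schrodinger k V hV).domain)
    (hf : (f : HalfLineL2) =ᵐ[halfLine] conj k u) :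
    (schrodinger k V hV f : HalfLineL2) =ᵐ[halfLine] halfLineExpr k V (conj k u) := by
  refine (MemLp.coeFn_toLp ((domainRep_isRadialH2 k f).memLp_halfLineExpr hV)).trans ?_
  exact (domainRep_isRadialH2 k f).halfLineExpr_congr hu V ((domainRep_ae_eq k f).symm.trans hf)

/-! ### The potentials are bounded -/

lemma tanh_half_div_sinh_le {r : ℝ} (hr : 0 < r) :
    Real.tanh (r / 2) ^ 2 / Real.sinh r ^ 2 ≤ 1 := by
  have hs : 0 < Real.sinh (r / 2) := Real.sinh_pos_iff.mpr (by linarith)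
  have hc := Real.one_le_cosh (r / 2)
  have h2 : Real.sinh r = 2 * Real.sinh (r / 2) * Real.cosh (r / 2) := by
    rw [← Real.sinh_two_mul]
    ring_nf
  have h3 : Real.tanh (r / 2) ≤ Real.sinh r := by
    rw [Real.tanh_eq_sinh_div_cosh, h2, div_le_iff₀ (by linarith)]
    nlinarith [mul_pos hs hs, mul_le_mul hc hc zero_le_one (by linarith)]
  have h4 : 0 ≤ Real.tanh (r / 2) := by
    rw [Real.tanh_eq_sinh_div_cosh]
    exact div_nonneg hs.le (by linarith)
  have h5 : 0 < Real.sinh r := Real.sinh_pos_iff.mpr hr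
  rw [div_le_one (by positivity)]
  exact pow_le_pow_left₀ h4 h3 2

lemma measurable_tanh_half : Measurable fun r : ℝ => Real.tanh (r / 2) := by
  simp only [Real.tanh_eq_sinh_div_cosh]
  exact (Real.measurable_sinh.comp (measurable_id.div_const 2)).div
    (Real.measurable_cosh.comp (measurable_id.div_const 2))

lemma memLp_potentialV (k : ℕ) (lam : ℝ) : MemLp (potentialV k lam) ⊤ halfLine := by
  have ht := measurable_tanh_half
  have hm : Measurable (potentialV k lam) := by
    have h1 : Measurable (harmonicMap k lam) :=
      (Real.measurable_arctan.comp ((ht.pow_const k).const_mul _)).const_mul 2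
    exact (((Real.measurable_cos.comp (h1.const_mul 2)).sub_const 1).const_mul _).div
      (Real.measurable_sinh.pow_const 2)
  refine memLp_top_of_bound hm.aestronglyMeasurable ((k : ℝ) ^ 2 * (8 * (lam ^ k) ^ 2)) ?_
  filter_upwards [ae_restrict_mem measurableSet_Ioi] with r hr
  have hr0 : 0 < r := hr
  have hs : 0 < Real.sinh r := Real.sinh_pos_iff.mpr hr0
  rcases Nat.eq_zero_or_pos k with rfl | hk
  · simp [potentialV]
  set x := lam ^ k * Real.tanh (r / 2) ^ k with hx
  have h1 : Real.cos (2 * harmonicMap k lam r) - 1 = - (8 * x ^ 2 / (1 + x ^ 2) ^ 2) := by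
    have hc := Real.cos_sq_arctan x
    rw [harmonicMap, Real.cos_two_mul, Real.cos_two_mul, ← hx, hc]
    field_simp
    ring
  have hb : |8 * x ^ 2 / (1 + x ^ 2) ^ 2| ≤ 8 * x ^ 2 := by
    rw [abs_of_nonneg (by positivity)]
    apply div_le_self (by positivity)
    nlinarith [sq_nonneg x]
  have hx2 : x ^ 2 ≤ (lam ^ k) ^ 2 * Real.tanh (r / 2) ^ 2 := by
    rw [hx, mul_pow, pow_right_comm (Real.tanh _)]
    refine mul_le_mul_of_nonneg_left ?_ (sq_nonneg _)
    refine pow_le_of_le_one (sq_nonneg _) ?_ hk.ne'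
    nlinarith [Real.tanh_lt_one (r / 2), Real.neg_one_lt_tanh (r / 2)]
  have ht2 := tanh_half_div_sinh_le hr0
  rw [div_le_one (by positivity)] at ht2
  rw [potentialV, h1, Real.norm_eq_abs, abs_div, abs_mul, abs_neg,
    abs_of_nonneg (by positivity : (0 : ℝ) ≤ (k : ℝ) ^ 2),
    abs_of_nonneg (by positivity : (0 : ℝ) ≤ Real.sinh r ^ 2), div_le_iff₀ (by positivity),
    mul_assoc]
  refine mul_le_mul_of_nonneg_left ?_ (by positivity)
  have := mul_le_mul_of_nonneg_left ht2 (by positivity : (0 : ℝ) ≤ (lam ^ k) ^ 2)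
  linarith

lemma memLp_potentialW (lam : ℝ) : MemLp (potentialW lam) ⊤ halfLine := by
  have ht := measurable_tanh_half
  have hm : Measurable (potentialW lam) := by
    have h1 : Measurable (yangMillsMap lam) :=
      ((ht.pow_const 2).const_mul _).div (((ht.pow_const 2).const_mul _).const_add 1)
    exact ((h1.const_mul 6).mul (h1.sub_const 2)).div (Real.measurable_sinh.pow_const 2)
  refine memLp_top_of_bound hm.aestronglyMeasurable (24 * lam ^ 2) ?_
  filter_upwards [ae_restrict_mem measurableSet_Ioi] with r hr
  have hr0 : 0 < r := hr
  have hs : 0 < Real.sinh r := Real.sinh_pos_iff.mpr hr0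
  have ht2 := tanh_half_div_sinh_le hr0
  rw [div_le_one (by positivity)] at ht2
  set x := lam ^ 2 * Real.tanh (r / 2) ^ 2 with hx
  have hx0 : 0 ≤ x := by positivity
  have h1 : 6 * yangMillsMap lam r * (yangMillsMap lam r - 2) = - (24 * x / (1 + x) ^ 2) := by
    rw [yangMillsMap, mul_assoc 2, ← hx]
    field_simp
    ring
  have hb : |24 * x / (1 + x) ^ 2| ≤ 24 * x := by
    rw [abs_of_nonneg (by positivity)]
    apply div_le_self (by positivity)
    nlinarith
  rw [potentialW, h1, Real.norm_eq_abs, abs_div, abs_neg,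
    abs_of_nonneg (by positivity : (0 : ℝ) ≤ Real.sinh r ^ 2), div_le_iff₀ (by positivity)]
  have := mul_le_mul_of_nonneg_left ht2 (by positivity : (0 : ℝ) ≤ lam ^ 2)
  linarith

/-- `𝓛_{V_{λ,k}}`. -/
def opV (k : ℕ) (lam : ℝ) : HalfLineL2 →ₗ.[ℂ] HalfLineL2 :=
  schrodinger k (potentialV k lam) (memLp_potentialV k lam)

/-- `𝓛_{W_λ}`; here `k = 2`. -/
def opW (lam : ℝ) : HalfLineL2 →ₗ.[ℂ] HalfLineL2 :=
  schrodinger 2 (potentialW lam) (memLp_potentialW lam)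

/-! ### Spectrum and eigenvalues of an unbounded operator -/

/-- The resolvent set of an unbounded operator `T`: the `z ∈ ℂ` for which `T - z` is a bijection
from the domain of `T` onto the whole space, with a bounded inverse `R`. -/
def resolventSet {H : Type*} [NormedAddCommGroup H] [NormedSpace ℂ H] (T : H →ₗ.[ℂ] H) : Set ℂ :=
  {z | ∃ R : H →L[ℂ] H,
    (∀ g : H, ∃ f : T.domain, (f : H) = R g ∧ T f - z • (f : H) = g) ∧
    ∀ f : T.domain, R (T f - z • (f : H)) = f}

/-- The spectrum: the complement of the resolvent set. -/
def spec {H : Type*} [NormedAddCommGroup H] [NormedSpace ℂ H] (T : H →ₗ.[ℂ] H) : Set ℂ :=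
  (resolventSet T)ᶜ

/-- `z` is an eigenvalue of `T`. -/
def IsEigenvalue {H : Type*} [NormedAddCommGroup H] [NormedSpace ℂ H] (T : H →ₗ.[ℂ] H)
    (z : ℂ) : Prop :=
  ∃ f : T.domain, (f : H) ≠ 0 ∧ T f = z • (f : H)

end HypGap

end

noncomputable section

namespace HypGap

open scoped ENNReal

/-! ### Integral operators and the Schur test -/

section Schur

variable {α : Type*} [MeasurableSpace α]

/-! Everything rests on a positive solution `φ` of `𝓛_V φ = 0`, regular at the origin. For `λ > 0`
it comes from moving along the family of stationary solutions: `λ ∂_λ Q` is a multiple of `tanh^k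
(r/2) / (1 + X)^p` with `X = (λ tanh (r/2))^n`, where `(n, p) = (2k, 1)` for the harmonic maps and
`(n, p) = (2, 2)` for Yang-Mills. With the power of `λ` divided out the formula also serves `λ = 0`.
Multiplied by `√(sinh r)` it gives `φ`. The structure `GroundState` records what is needed of it,
and `instanton` supplies it in both cases.

With `w = φ'/φ` the expression factors as `𝓛_V = (-∂ - w)(∂ - w)`. Its formal inverse is `G = K* K`,
where `K g = φ⁻¹ ∫₀^r φ g`. Since `ψ = φ / √(sinh r)` is monotone up to a constant, the kernel of
`K` is dominated by `(sinh s / sinh r)^{1/2}`, and the Schur test makes `K` bounded, even after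
multiplication by `coth r`. This extra factor places `G g` in the domain
(`isRadialH2_radialSolution`). A Wronskian argument shows that `𝓛_V` is injective
(`conj_eq_zero_of_halfLineExpr`), because `φ⁻¹` is not square integrable at the origin and `φ` is
not at infinity. Hence `G` is a bounded positive two-sided inverse.

For `m ≤ 0` one has `𝓛_V - m = (1 - m G) 𝓛_V` with `1 - m G ≥ 1`, so `m` is in the resolvent set. If
`𝓛_V f = z f`, then `z ⟨f, G f⟩ = ‖f‖²`, so `z` is real and positive.

For `m ≥ 1/4` the eigenvalue equation reads `f'' = (q - E) f` with `E = m - 1/4 ≥ 0` and `q =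
O(e^{-2r})`. An energy estimate (`eq_zero_of_memLp_of_decay`) shows that a nonzero solution cannot
have both `f` and `f'` in `L²` near infinity. -/

lemma sq_lintegral_mul_le {μ : Measure α} {k g : α → ℝ≥0∞} (hk : AEMeasurable k μ)
    (hg : AEMeasurable g μ) :
    (∫⁻ x, k x * g x ∂μ) ^ 2 ≤ (∫⁻ x, k x ∂μ) * ∫⁻ x, k x * g x ^ 2 ∂μ := by
  -- Cauchy-Schwarz for the splitting `k g = k^{1/2} (k g²)^{1/2}`.
  have h := ENNReal.lintegral_mul_norm_pow_le hk (hk.mul (hg.pow_const 2))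
    (p := 1 / 2) (q := 1 / 2) (by norm_num) (by norm_num) (by norm_num)
  have e : ∀ x, k x ^ (1 / 2 : ℝ) * (k x * g x ^ 2) ^ (1 / 2 : ℝ) = k x * g x := fun x => by
    rw [← ENNReal.mul_rpow_of_nonneg _ _ (by norm_num : (0 : ℝ) ≤ 1 / 2), ← mul_assoc, ← sq,
      ← mul_pow, ← ENNReal.rpow_natCast, ← ENNReal.rpow_mul]
    norm_num
  simp only [Pi.mul_apply, e] at h
  refine (pow_le_pow_left₀ zero_le h 2).trans (le_of_eq ?_)
  rw [← ENNReal.mul_rpow_of_nonneg _ _ (by norm_num : (0 : ℝ) ≤ 1 / 2), ← ENNReal.rpow_natCast,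
    ← ENNReal.rpow_mul]
  norm_num

/-- The hypothesis of the Schur test: the rows and the columns of the kernel `K` have
`L¹` norm at most `A`. -/
structure IsSchurKernel (μ : Measure α) (K : α → α → ℝ) (A : ℝ≥0∞) : Prop where
  measurable : Measurable (Function.uncurry K)
  ne_top : A ≠ ⊤
  row : ∀ᵐ x ∂μ, ∫⁻ y, ‖K x y‖ₑ ∂μ ≤ A
  col : ∀ᵐ y ∂μ, ∫⁻ x, ‖K x y‖ₑ ∂μ ≤ A

variable {μ : Measure α} {K : α → α → ℝ} {A : ℝ≥0∞}

lemma IsSchurKernel.swap (h : IsSchurKernel μ K A) : IsSchurKernel μ (fun x y => K y x) A :=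
  ⟨h.measurable.comp measurable_swap, h.ne_top, h.col, h.row⟩

lemma eLpNorm_two_sq {E : Type*} [NormedAddCommGroup E] (f : α → E) :
    eLpNorm f 2 μ ^ 2 = ∫⁻ x, ‖f x‖ₑ ^ 2 ∂μ := by
  have := eLpNorm_nnreal_pow_eq_lintegral (μ := μ) (f := f) (p := 2) two_ne_zero
  simpa using this

/-- The integral transform with kernel `K`. -/
def kernelFun (μ : Measure α) (K : α → α → ℝ) (g : α → ℂ) (x : α) : ℂ :=
  ∫ y, (K x y : ℂ) * g y ∂μ

lemma IsSchurKernel.aestronglyMeasurable_uncurry (h : IsSchurKernel μ K A) {g : α → ℂ}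
    (hg : MemLp g 2 μ) :
    AEStronglyMeasurable (fun p : α × α => (K p.1 p.2 : ℂ) * g p.2) (μ.prod μ) :=
  (Complex.continuous_ofReal.measurable.comp h.measurable).aestronglyMeasurable.mul
    hg.aestronglyMeasurable.comp_snd

lemma enorm_kernelFun_le (K : α → α → ℝ) (g : α → ℂ) (x : α) :
    ‖kernelFun μ K g x‖ₑ ≤ ∫⁻ y, ‖K x y‖ₑ * ‖g y‖ₑ ∂μ := by
  refine (enorm_integral_le_lintegral_enorm _).trans (le_of_eq (lintegral_congr fun y => ?_))
  rw [enorm_mul, ← ofReal_norm, Complex.norm_real, ofReal_norm]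

lemma kernelFun_congr {f g : α → ℂ} (h : f =ᵐ[μ] g) : kernelFun μ K f = kernelFun μ K g := by
  funext x
  refine integral_congr_ae ?_
  filter_upwards [h] with y hy
  rw [hy]

variable [SFinite μ]

lemma IsSchurKernel.lintegral_sq_le (h : IsSchurKernel μ K A) {g : α → ℝ≥0∞}
    (hg : AEMeasurable g μ) :
    ∫⁻ x, (∫⁻ y, ‖K x y‖ₑ * g y ∂μ) ^ 2 ∂μ ≤ A ^ 2 * ∫⁻ y, g y ^ 2 ∂μ := by
  have hK := h.measurable
  have hKx : ∀ x, Measurable fun y => ‖K x y‖ₑ := fun x =>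
    (hK.comp (measurable_const.prodMk measurable_id)).enorm
  have hKy : ∀ y, Measurable fun x => ‖K x y‖ₑ := fun y =>
    (hK.comp (measurable_id.prodMk measurable_const)).enorm
  calc ∫⁻ x, (∫⁻ y, ‖K x y‖ₑ * g y ∂μ) ^ 2 ∂μ
      ≤ ∫⁻ x, A * ∫⁻ y, ‖K x y‖ₑ * g y ^ 2 ∂μ ∂μ := by
        refine lintegral_mono_ae ?_
        filter_upwards [h.row] with x hx
        exact (sq_lintegral_mul_le (hKx x).aemeasurable hg).trans (by gcongr)
    _ = A * ∫⁻ x, ∫⁻ y, ‖K x y‖ₑ * g y ^ 2 ∂μ ∂μ := lintegral_const_mul' _ _ h.ne_top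
    _ = A * ∫⁻ y, ∫⁻ x, ‖K x y‖ₑ * g y ^ 2 ∂μ ∂μ := by
        rw [lintegral_lintegral_swap]
        exact hK.enorm.aemeasurable.mul (hg.pow_const 2).comp_snd
    _ = A * ∫⁻ y, (∫⁻ x, ‖K x y‖ₑ ∂μ) * g y ^ 2 ∂μ := by
        congr 1
        refine lintegral_congr fun y => ?_
        rw [lintegral_mul_const _ (hKy y)]
    _ ≤ A * ∫⁻ y, A * g y ^ 2 ∂μ := by
        gcongr A * ?_
        refine lintegral_mono_ae ?_
        filter_upwards [h.col] with y hy
        gcongr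
    _ = A ^ 2 * ∫⁻ y, g y ^ 2 ∂μ := by
        rw [lintegral_const_mul' _ _ h.ne_top, sq, mul_assoc]

lemma IsSchurKernel.lintegral_sq_lt_top (h : IsSchurKernel μ K A) {g : α → ℂ}
    (hg : MemLp g 2 μ) : ∫⁻ x, (∫⁻ y, ‖K x y‖ₑ * ‖g y‖ₑ ∂μ) ^ 2 ∂μ < ⊤ := by
  refine (h.lintegral_sq_le hg.aestronglyMeasurable.enorm).trans_lt ?_
  rw [← eLpNorm_two_sq]
  exact ENNReal.mul_lt_top (ENNReal.pow_lt_top h.ne_top.lt_top) (ENNReal.pow_lt_top hg.2)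

lemma IsSchurKernel.aemeasurable_lintegral (h : IsSchurKernel μ K A) {g : α → ℂ}
    (hg : MemLp g 2 μ) : AEMeasurable (fun x => ∫⁻ y, ‖K x y‖ₑ * ‖g y‖ₑ ∂μ) μ :=
  (h.measurable.enorm.aemeasurable.mul
    hg.aestronglyMeasurable.enorm.comp_snd).lintegral_prod_right'

/-- The absolute integral of row `x` is a square integrable function of `x`, hence finite almost
everywhere. Besides linearity of the operator, this later yields local integrability statements, by
picking one good `x`. -/
lemma IsSchurKernel.ae_integrable (h : IsSchurKernel μ K A) {g : α → ℂ} (hg : MemLp g 2 μ) :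
    ∀ᵐ x ∂μ, Integrable (fun y => (K x y : ℂ) * g y) μ := by
  filter_upwards [ae_lt_top' ((h.aemeasurable_lintegral hg).pow_const 2)
    (h.lintegral_sq_lt_top hg).ne] with x hx
  refine ⟨(Complex.continuous_ofReal.measurable.comp (h.measurable.comp
    (measurable_const.prodMk measurable_id))).aestronglyMeasurable.mul
    hg.aestronglyMeasurable, ?_⟩
  rw [hasFiniteIntegral_iff_enorm]
  simp only [enorm_mul]
  have e : ∀ y, ‖(K x y : ℂ)‖ₑ = ‖K x y‖ₑ := fun y => by
    rw [← ofReal_norm, ← ofReal_norm, Complex.norm_real]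
  simp only [e]
  exact (ENNReal.pow_lt_top_iff.1 hx).resolve_right two_ne_zero

lemma IsSchurKernel.eLpNorm_kernelFun_le (h : IsSchurKernel μ K A) {g : α → ℂ}
    (hg : MemLp g 2 μ) : eLpNorm (kernelFun μ K g) 2 μ ≤ A * eLpNorm g 2 μ := by
  rw [← ENNReal.pow_le_pow_left_iff two_ne_zero, mul_pow, eLpNorm_two_sq, eLpNorm_two_sq]
  refine le_trans (lintegral_mono fun x => ?_) (h.lintegral_sq_le hg.aestronglyMeasurable.enorm)
  exact pow_le_pow_left₀ zero_le (enorm_kernelFun_le K g x) 2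

lemma IsSchurKernel.memLp_kernelFun (h : IsSchurKernel μ K A) {g : α → ℂ}
    (hg : MemLp g 2 μ) : MemLp (kernelFun μ K g) 2 μ :=
  ⟨(h.aestronglyMeasurable_uncurry hg).integral_prod_right',
    (h.eLpNorm_kernelFun_le hg).trans_lt (ENNReal.mul_lt_top h.ne_top.lt_top hg.2)⟩

/-- The bounded operator on `L²` with kernel `K`. -/
def IsSchurKernel.op (h : IsSchurKernel μ K A) : Lp ℂ 2 μ →L[ℂ] Lp ℂ 2 μ :=
  LinearMap.mkContinuous
    { toFun := fun g => (h.memLp_kernelFun (Lp.memLp g)).toLp _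
      map_add' := fun f g => by
        rw [← MemLp.toLp_add, MemLp.toLp_eq_toLp_iff, kernelFun_congr (Lp.coeFn_add f g)]
        filter_upwards [h.ae_integrable (Lp.memLp f), h.ae_integrable (Lp.memLp g)] with x h1 h2
        rw [Pi.add_apply, kernelFun, kernelFun, kernelFun, ← integral_add h1 h2]
        simp only [Pi.add_apply, mul_add]
      map_smul' := fun c f => by
        rw [RingHom.id_apply, ← MemLp.toLp_const_smul, MemLp.toLp_eq_toLp_iff,
          kernelFun_congr (Lp.coeFn_smul c f)]
        refine Eventually.of_forall fun x => ?_
        rw [Pi.smul_apply, kernelFun, kernelFun, ← integral_smul]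
        refine integral_congr_ae (Eventually.of_forall fun y => ?_)
        simp only [Pi.smul_apply, smul_eq_mul]
        ring }
    A.toReal fun g => by
      simp only [LinearMap.coe_mk, AddHom.coe_mk, Lp.norm_toLp]
      rw [Lp.norm_def, ← ENNReal.toReal_mul]
      exact ENNReal.toReal_mono (ENNReal.mul_ne_top h.ne_top (Lp.eLpNorm_ne_top g))
        (h.eLpNorm_kernelFun_le (Lp.memLp g))

lemma IsSchurKernel.coeFn_op (h : IsSchurKernel μ K A) (g : Lp ℂ 2 μ) :
    h.op g =ᵐ[μ] kernelFun μ K g :=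
  MemLp.coeFn_toLp (h.memLp_kernelFun (Lp.memLp g))

/-- By `a b ≤ a² + b²`, with `a = |f|` and `b = ∫ |K| |g|`, the double integral is controlled by two
finite `L²` norms. This licenses Fubini in `integral_mul_kernelFun`. -/
lemma IsSchurKernel.integrable_prod (h : IsSchurKernel μ K A) {f g : α → ℂ}
    (hf : MemLp f 2 μ) (hg : MemLp g 2 μ) :
    Integrable (fun p : α × α => f p.1 * ((K p.1 p.2 : ℂ) * g p.2)) (μ.prod μ) := by
  have hm : AEStronglyMeasurable (fun p : α × α => f p.1 * ((K p.1 p.2 : ℂ) * g p.2))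
      (μ.prod μ) := hf.aestronglyMeasurable.comp_fst.mul (h.aestronglyMeasurable_uncurry hg)
  refine ⟨hm, ?_⟩
  rw [hasFiniteIntegral_iff_enorm, lintegral_prod _ hm.enorm]
  have e : ∀ x y, ‖f x * ((K x y : ℂ) * g y)‖ₑ = ‖f x‖ₑ * (‖K x y‖ₑ * ‖g y‖ₑ) := fun x y => by
    rw [enorm_mul, enorm_mul]
    congr 2
    rw [← ofReal_norm, Complex.norm_real, ofReal_norm]
  have h1 : ∀ x, ∫⁻ y, ‖f x‖ₑ * (‖K x y‖ₑ * ‖g y‖ₑ) ∂μ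
      = ‖f x‖ₑ * ∫⁻ y, ‖K x y‖ₑ * ‖g y‖ₑ ∂μ := fun x => lintegral_const_mul' _ _ enorm_ne_top
  simp only [e, h1]
  have h2 : ∀ a b : ℝ≥0∞, a * b ≤ a ^ 2 + b ^ 2 := fun a b => by
    rcases le_total a b with hab | hab
    · exact (mul_le_mul_left hab b).trans (by rw [← sq]; exact le_add_self)
    · exact (mul_le_mul_right hab a).trans (by rw [← sq]; exact le_self_add)
  refine (lintegral_mono fun x => h2 _ _).trans_lt ?_
  rw [lintegral_add_left' (hf.aestronglyMeasurable.enorm.pow_const 2), ← eLpNorm_two_sq]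
  exact ENNReal.add_lt_top.2 ⟨ENNReal.pow_lt_top hf.2, h.lintegral_sq_lt_top hg⟩

lemma IsSchurKernel.integral_mul_kernelFun (h : IsSchurKernel μ K A) {f g : α → ℂ}
    (hf : MemLp f 2 μ) (hg : MemLp g 2 μ) :
    ∫ x, f x * kernelFun μ K g x ∂μ = ∫ y, g y * kernelFun μ (fun y x => K x y) f y ∂μ := by
  have h1 : ∀ x, f x * kernelFun μ K g x = ∫ y, f x * ((K x y : ℂ) * g y) ∂μ := fun x =>
    (integral_const_mul _ _).symm
  have h2 : ∀ y, g y * kernelFun μ (fun y x => K x y) f y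
      = ∫ x, f x * ((K x y : ℂ) * g y) ∂μ := fun y => by
    rw [kernelFun, ← integral_const_mul]
    congr 1
    funext x
    ring
  simp only [h1, h2]
  exact integral_integral_swap (f := fun x y => f x * ((K x y : ℂ) * g y))
    (h.integrable_prod hf hg)

/-- Because the kernel is real, conjugation passes through it to `f`, and Fubini exchanges rows and
columns. -/
lemma IsSchurKernel.inner_op_left {K' : α → α → ℝ} {B : ℝ≥0∞} (h : IsSchurKernel μ K A)
    (h' : IsSchurKernel μ K' B) (hK : ∀ x y, K' x y = K y x) (f g : Lp ℂ 2 μ) :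
    inner ℂ (h'.op f) g = inner ℂ f (h.op g) := by
  have hf : MemLp (fun y => (starRingEnd ℂ) ((f : α → ℂ) y)) 2 μ := (Lp.memLp f).star
  rw [L2.inner_def, L2.inner_def]
  refine Eq.trans (integral_congr_ae ?_) ((h'.integral_mul_kernelFun (Lp.memLp g) hf).trans
    (integral_congr_ae ?_))
  · filter_upwards [h'.coeFn_op f] with x hx
    rw [hx, RCLike.inner_apply, kernelFun, kernelFun, ← integral_conj]
    simp
  · filter_upwards [h.coeFn_op g] with y hy
    have e : (fun y x => K' x y) = K := by
      funext x y
      exact hK y x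
    rw [hy, RCLike.inner_apply, e, mul_comm]

lemma IsSchurKernel.op_eq_adjoint {K' : α → α → ℝ} {B : ℝ≥0∞} (h : IsSchurKernel μ K A)
    (h' : IsSchurKernel μ K' B) (hK : ∀ x y, K' x y = K y x) :
    h'.op = ContinuousLinearMap.adjoint h.op :=
  (ContinuousLinearMap.eq_adjoint_iff _ _).2 (h.inner_op_left h' hK)

end Schur

/-! ### The kernel `coth r · (sinh s / sinh r)^{1/2}` -/

lemma hasDerivAt_sqrt_sinh {r : ℝ} (hr : 0 < r) :
    HasDerivAt (fun r => √(Real.sinh r)) (Real.cosh r / Real.sinh r / 2 * √(Real.sinh r)) r := by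
  have hs : 0 < Real.sinh r := Real.sinh_pos_iff.mpr hr
  refine ((Real.hasDerivAt_sinh r).sqrt hs.ne').congr_deriv ?_
  have := Real.sq_sqrt hs.le
  have h2 : √(Real.sinh r) ≠ 0 := (Real.sqrt_pos.2 hs).ne'
  field_simp
  linear_combination (-1) * this

/-- The right side vanishes at `0` and has derivative `√(sinh r) (3 - 2 tanh² r) ≥ √(sinh r)`. Its
form is such that the prefactor `coth r / √(sinh r)` of the Schur row integral leaves exactly `2`.
-/
lemma integral_sqrt_sinh_le {r : ℝ} (hr : 0 < r) :
    ∫ s in (0 : ℝ)..r, √(Real.sinh s) ≤ 2 * (Real.sinh r * √(Real.sinh r) / Real.cosh r) := by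
  have hc : Continuous fun s => √(Real.sinh s) := Real.continuous_sqrt.comp Real.continuous_sinh
  have hd : ∀ x ∈ Ioo 0 r, HasDerivWithinAt
      (fun r => 2 * (Real.sinh r * √(Real.sinh r) / Real.cosh r))
      (√(Real.sinh x) * (3 - 2 * (Real.sinh x ^ 2 / Real.cosh x ^ 2))) (Ioi x) x := fun x hx => by
    have hs : 0 < Real.sinh x := Real.sinh_pos_iff.mpr hx.1
    have hch := Real.cosh_pos x
    refine (((((Real.hasDerivAt_sinh x).mul (hasDerivAt_sqrt_sinh hx.1)).div
      (Real.hasDerivAt_cosh x) hch.ne').const_mul 2).congr_deriv ?_).hasDerivWithinAt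
    simp only [Pi.mul_apply]
    field_simp
    ring
  have h := intervalIntegral.integral_le_sub_of_hasDeriv_right_of_le hr.le
    (g := fun r => 2 * (Real.sinh r * √(Real.sinh r) / Real.cosh r))
    (φ := fun s => √(Real.sinh s)) ?_ hd
    hc.continuousOn.integrableOn_Icc ?_
  · simpa using h
  · exact (continuous_const.mul ((Real.continuous_sinh.mul hc).div Real.continuous_cosh
      fun x => (Real.cosh_pos x).ne')).continuousOn
  · intro x hx
    have hch := Real.cosh_pos x
    have : Real.sinh x ^ 2 / Real.cosh x ^ 2 ≤ 1 := by
      rw [div_le_one (by positivity), Real.cosh_sq x]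
      linarith
    have := Real.sqrt_nonneg (Real.sinh x)
    nlinarith

lemma hasDerivAt_inv_sqrt_sinh {r : ℝ} (hr : 0 < r) :
    HasDerivAt (fun r => -2 * (√(Real.sinh r))⁻¹)
      (Real.cosh r / Real.sinh r * (√(Real.sinh r))⁻¹) r := by
  have hs : 0 < Real.sinh r := Real.sinh_pos_iff.mpr hr
  have h2 : √(Real.sinh r) ≠ 0 := (Real.sqrt_pos.2 hs).ne'
  refine (((hasDerivAt_sqrt_sinh hr).inv h2).const_mul (-2)).congr_deriv ?_
  field_simp

lemma tendsto_sinh_atTop : Tendsto Real.sinh atTop atTop := by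
  refine tendsto_atTop_mono' atTop ?_ tendsto_id
  filter_upwards [eventually_ge_atTop 0] with x hx
  exact Real.self_le_sinh_iff.2 hx

/-- The integrand has the primitive `-2 (sinh r)^{-1/2}`, which tends to `0` at infinity. This is
the column integral of the Schur test. -/
lemma lintegral_coth_inv_sqrt_sinh {s : ℝ} (hs : 0 < s) :
    ∫⁻ r in Ioi s, ENNReal.ofReal (Real.cosh r / Real.sinh r * (√(Real.sinh r))⁻¹) =
      ENNReal.ofReal (2 * (√(Real.sinh s))⁻¹) := by
  have hd : ∀ x ∈ Ioi s, HasDerivAt (fun r => -2 * (√(Real.sinh r))⁻¹)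
      (Real.cosh x / Real.sinh x * (√(Real.sinh x))⁻¹) x := fun x hx =>
    hasDerivAt_inv_sqrt_sinh (hs.trans hx)
  have hnn : ∀ x ∈ Ioi s, 0 ≤ Real.cosh x / Real.sinh x * (√(Real.sinh x))⁻¹ := fun x hx => by
    have : 0 < Real.sinh x := Real.sinh_pos_iff.mpr (hs.trans hx)
    have := Real.cosh_pos x
    positivity
  have hc : ContinuousWithinAt (fun r => -2 * (√(Real.sinh r))⁻¹) (Ici s) s :=
    (hasDerivAt_inv_sqrt_sinh hs).continuousAt.continuousWithinAt
  have ht : Tendsto (fun r => -2 * (√(Real.sinh r))⁻¹) atTop (𝓝 0) := by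
    have := (tendsto_inv_atTop_zero.comp
      (Real.tendsto_sqrt_atTop.comp tendsto_sinh_atTop)).const_mul (-2 : ℝ)
    simpa using this
  rw [← ofReal_integral_eq_lintegral_ofReal (integrableOn_Ioi_deriv_of_nonneg hc hd hnn ht)
    ((ae_restrict_iff' measurableSet_Ioi).2 (Eventually.of_forall hnn)),
    integral_Ioi_of_hasDerivAt_of_nonneg hc hd hnn ht]
  ring_nf

/-- The Schur test for Volterra kernels dominated by `coth r · (sinh s / sinh r)^{1/2}`. -/
lemma isSchurKernel_of_le {K : ℝ → ℝ → ℝ} {C : ℝ} (hC : 0 ≤ C)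
    (hm : Measurable (Function.uncurry K)) (h0 : ∀ r s, ¬(0 < s ∧ s < r) → K r s = 0)
    (h : ∀ r s, 0 < s → s < r →
      |K r s| ≤ C * (Real.cosh r / Real.sinh r * (√(Real.sinh s) / √(Real.sinh r)))) :
    IsSchurKernel halfLine K (ENNReal.ofReal (2 * C)) := by
  refine ⟨hm, ENNReal.ofReal_ne_top, ?_, ?_⟩
  · filter_upwards [ae_restrict_mem measurableSet_Ioi] with r hr
    have hr : 0 < r := hr
    have hs : 0 < Real.sinh r := Real.sinh_pos_iff.mpr hr
    have hch := Real.cosh_pos r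
    have hq : 0 < √(Real.sinh r) := Real.sqrt_pos.2 hs
    have hc : Continuous fun s => √(Real.sinh s) := Real.continuous_sqrt.comp Real.continuous_sinh
    calc ∫⁻ s in Ioi 0, ‖K r s‖ₑ
        ≤ ∫⁻ s in Ioi 0, (Ioc 0 r).indicator (fun s => ENNReal.ofReal
            (C * (Real.cosh r / Real.sinh r / √(Real.sinh r)) * √(Real.sinh s))) s := by
          refine lintegral_mono fun s => ?_
          by_cases hsr : 0 < s ∧ s < r
          · rw [indicator_of_mem (show s ∈ Ioc 0 r from ⟨hsr.1, hsr.2.le⟩), ← ofReal_norm]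
            refine ENNReal.ofReal_le_ofReal ((h r s hsr.1 hsr.2).trans (le_of_eq ?_))
            ring
          · rw [h0 r s hsr]
            simp
      _ ≤ ∫⁻ s in Ioc 0 r, ENNReal.ofReal
            (C * (Real.cosh r / Real.sinh r / √(Real.sinh r)) * √(Real.sinh s)) := by
          rw [← lintegral_indicator measurableSet_Ioc]
          exact setLIntegral_le_lintegral _ _
      _ = ENNReal.ofReal (∫ s in Ioc 0 r,
            C * (Real.cosh r / Real.sinh r / √(Real.sinh r)) * √(Real.sinh s)) := by
          rw [ofReal_integral_eq_lintegral_ofReal]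
          · exact ((continuous_const.mul hc).integrableOn_Ioc)
          · exact Eventually.of_forall fun s => by positivity
      _ ≤ ENNReal.ofReal (2 * C) := by
          apply ENNReal.ofReal_le_ofReal
          rw [← intervalIntegral.integral_of_le hr.le, intervalIntegral.integral_const_mul]
          refine (mul_le_mul_of_nonneg_left (integral_sqrt_sinh_le hr) (by positivity)).trans
            (le_of_eq ?_)
          field_simp
  · filter_upwards [ae_restrict_mem measurableSet_Ioi] with s hs
    have hs : 0 < s := hs
    have hss : 0 < Real.sinh s := Real.sinh_pos_iff.mpr hs
    have hq : 0 < √(Real.sinh s) := Real.sqrt_pos.2 hss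
    calc ∫⁻ r in Ioi 0, ‖K r s‖ₑ
        ≤ ∫⁻ r in Ioi 0, (Ioi s).indicator (fun r => ENNReal.ofReal (C * √(Real.sinh s)) *
            ENNReal.ofReal (Real.cosh r / Real.sinh r * (√(Real.sinh r))⁻¹)) r := by
          refine lintegral_mono fun r => ?_
          by_cases hsr : 0 < s ∧ s < r
          · rw [indicator_of_mem (show r ∈ Ioi s from hsr.2), ← ofReal_norm,
              ← ENNReal.ofReal_mul (by positivity)]
            refine ENNReal.ofReal_le_ofReal ((h r s hsr.1 hsr.2).trans (le_of_eq ?_))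
            ring
          · rw [h0 r s hsr]
            simp
      _ ≤ ∫⁻ r in Ioi s, ENNReal.ofReal (C * √(Real.sinh s)) *
            ENNReal.ofReal (Real.cosh r / Real.sinh r * (√(Real.sinh r))⁻¹) := by
          exact (setLIntegral_le_lintegral _ _).trans
            (lintegral_indicator measurableSet_Ioi _).le
      _ = ENNReal.ofReal (2 * C) := by
          rw [lintegral_const_mul' _ _ ENNReal.ofReal_ne_top, lintegral_coth_inv_sqrt_sinh hs,
            ← ENNReal.ofReal_mul (by positivity)]
          congr 1
          field_simp

/-! ### Positive zero-energy solutions -/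

/-- A positive solution `√(sinh r) ψ(r)` of `𝓛_V φ = 0` that is regular at the origin, given through
`ψ` and `a = sinh r · ψ' / ψ`, which satisfies a Riccati equation. -/
structure GroundState (k : ℕ) (V : ℝ → ℝ) where
  ψ : ℝ → ℝ
  a : ℝ → ℝ
  a' : ℝ → ℝ
  C : ℝ
  measurable : Measurable ψ
  pos : ∀ r, 0 < r → 0 < ψ r
  hasDerivAt : ∀ r, 0 < r → HasDerivAt ψ (a r / Real.sinh r * ψ r) r
  hasDerivAt_a : ∀ r, 0 < r → HasDerivAt a (a' r) r
  riccati : ∀ r, 0 < r → Real.sinh r * a' r + a r ^ 2 = (k : ℝ) ^ 2 + Real.sinh r ^ 2 * V r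
  a_sub_le : ∀ r, 0 < r → |a r - k * Real.cosh r| * Real.cosh r ≤ C * Real.sinh r ^ 2
  le_mul : ∀ s r, 0 < s → s ≤ r → ψ s ≤ C * ψ r
  le_const : ∀ r, 0 < r → ψ r ≤ C
  potential_le : ∀ r, 0 < r → |V r| * Real.sinh r ^ 2 ≤ C
  continuousOn : ContinuousOn V (Ioi 0)

namespace GroundState

variable {k : ℕ} {V : ℝ → ℝ} (S : GroundState k V)

lemma C_nonneg : 0 ≤ S.C := (S.pos 1 one_pos).le.trans (S.le_const 1 one_pos)

/-- The solution itself. -/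
def φ (r : ℝ) : ℝ := √(Real.sinh r) * S.ψ r

/-- Its logarithmic derivative. -/
def logDeriv (r : ℝ) : ℝ := Real.cosh r / Real.sinh r / 2 + S.a r / Real.sinh r

lemma measurable_φ : Measurable S.φ :=
  (Real.measurable_sinh.sqrt).mul S.measurable

lemma φ_pos {r : ℝ} (hr : 0 < r) : 0 < S.φ r :=
  mul_pos (Real.sqrt_pos.2 (Real.sinh_pos_iff.mpr hr)) (S.pos r hr)

lemma hasDerivAt_φ {r : ℝ} (hr : 0 < r) : HasDerivAt S.φ (S.logDeriv r * S.φ r) r := by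
  refine ((hasDerivAt_sqrt_sinh hr).mul (S.hasDerivAt r hr)).congr_deriv ?_
  rw [logDeriv, φ]
  ring

/-- Equivalent to `𝓛_V φ = 0`, since `w' + w² = φ'' / φ` for `w = φ' / φ`. It follows from the
Riccati equation for `a` and `cosh² = 1 + sinh²`. -/
lemma hasDerivAt_logDeriv {r : ℝ} (hr : 0 < r) :
    HasDerivAt S.logDeriv
      (1 / 4 + ((k : ℝ) ^ 2 - 1 / 4) / Real.sinh r ^ 2 + V r - S.logDeriv r ^ 2) r := by
  have hs : 0 < Real.sinh r := Real.sinh_pos_iff.mpr hr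
  refine (((hasDerivAt_coth hr).div_const 2).add
    ((S.hasDerivAt_a r hr).div (Real.hasDerivAt_sinh r) hs.ne')).congr_deriv ?_
  have h1 := S.riccati r hr
  have h2 := Real.cosh_sq r
  rw [logDeriv]
  field_simp
  linear_combination 16 * h1 + 4 * h2

/-- The kernel of `g ↦ φ⁻¹ ∫₀^r φ g`. -/
def kernel (r s : ℝ) : ℝ := if 0 < s ∧ s < r then S.φ s / S.φ r else 0

lemma measurable_kernel : Measurable (Function.uncurry S.kernel) := by
  refine Measurable.ite ?_ ((S.measurable_φ.comp measurable_snd).div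
    (S.measurable_φ.comp measurable_fst)) measurable_const
  exact (measurableSet_lt measurable_const measurable_snd).inter
    (measurableSet_lt measurable_snd measurable_fst)

lemma φ_div_le {r s : ℝ} (hs : 0 < s) (hsr : s < r) :
    S.φ s / S.φ r ≤ S.C * (√(Real.sinh s) / √(Real.sinh r)) := by
  have hr := hs.trans hsr
  have h1 : 0 < √(Real.sinh r) := Real.sqrt_pos.2 (Real.sinh_pos_iff.mpr hr)
  have h2 : 0 < √(Real.sinh s) := Real.sqrt_pos.2 (Real.sinh_pos_iff.mpr hs)
  rw [div_le_iff₀ (S.φ_pos hr), φ, φ]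
  have := mul_le_mul_of_nonneg_left (S.le_mul s r hs hsr.le) h2.le
  refine this.trans (le_of_eq ?_)
  field_simp

lemma one_le_coth {r : ℝ} (hr : 0 < r) : 1 ≤ Real.cosh r / Real.sinh r := by
  rw [one_le_div (Real.sinh_pos_iff.mpr hr)]
  exact (Real.sinh_lt_cosh r).le

/-- The factor `coth r` is there because the `H²` norm contains `coth r · u'`. -/
lemma isSchurKernel_coth : IsSchurKernel halfLine
    (fun r s => Real.cosh r / Real.sinh r * S.kernel r s) (ENNReal.ofReal (2 * S.C)) := by
  refine isSchurKernel_of_le S.C_nonneg ?_ (fun r s h => by simp [kernel, h]) fun r s hs hsr => ?_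
  · exact ((Real.measurable_cosh.comp measurable_fst).div
      (Real.measurable_sinh.comp measurable_fst)).mul S.measurable_kernel
  · have hr := hs.trans hsr
    have h1 := zero_le_one.trans (one_le_coth hr)
    have h2 := S.φ_pos hs
    have h3 := S.φ_pos hr
    rw [kernel, if_pos ⟨hs, hsr⟩, abs_of_nonneg (by positivity), mul_left_comm]
    exact mul_le_mul_of_nonneg_left (S.φ_div_le hs hsr) h1

lemma isSchurKernel : IsSchurKernel halfLine S.kernel (ENNReal.ofReal (2 * S.C)) := by
  refine isSchurKernel_of_le S.C_nonneg S.measurable_kernel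
    (fun r s h => by simp [kernel, h]) fun r s hs hsr => ?_
  have hr := hs.trans hsr
  have h1 := one_le_coth hr
  have h2 := S.φ_pos hs
  have h3 := S.φ_pos hr
  have h4 : 0 ≤ √(Real.sinh s) / √(Real.sinh r) := by positivity
  rw [kernel, if_pos ⟨hs, hsr⟩, abs_of_nonneg (by positivity)]
  refine (S.φ_div_le hs hsr).trans (mul_le_mul_of_nonneg_left ?_ S.C_nonneg)
  nlinarith

end GroundState

/-! ### Absolute continuity -/

lemma absolutelyContinuous_of_hasDerivAt {E : Type*} [NormedAddCommGroup E] [NormedSpace ℝ E]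
    {f f' : ℝ → E} {a b : ℝ} (ha : 0 < a) (hab : a ≤ b) (hf : ∀ x, 0 < x → HasDerivAt f (f' x) x)
    (hf' : ContinuousOn f' (Ioi 0)) : AbsolutelyContinuousOnInterval f a b := by
  have hsub : Icc a b ⊆ Ioi 0 := fun x hx => ha.trans_le hx.1
  obtain ⟨C, hC⟩ := isCompact_Icc.exists_bound_of_continuousOn (hf'.mono hsub)
  have hL : LipschitzOnWith C.toNNReal f (uIcc a b) := by
    rw [uIcc_of_le hab]
    refine (convex_Icc a b).lipschitzOnWith_of_nnnorm_hasDerivWithin_le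
      (fun x hx => (hf x (hsub hx)).hasDerivWithinAt) fun x hx => ?_
    rw [← NNReal.coe_le_coe, coe_nnnorm]
    exact (hC x hx).trans (Real.le_coe_toNNReal C)
  exact hL.absolutelyContinuousOnInterval

lemma absolutelyContinuous_const {E : Type*} [NormedAddCommGroup E] (c : E) (a b : ℝ) :
    AbsolutelyContinuousOnInterval (fun _ : ℝ => c) a b :=
  LipschitzOnWith.absolutelyContinuousOnInterval (K := 0)
    (LipschitzWith.const c).lipschitzOnWith

/-- The integrand is only `L¹`, so no Lipschitz bound is available. The real and imaginary parts are
treated separately and recombined. -/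
lemma absolutelyContinuous_primitive {f : ℝ → ℂ} {a b c : ℝ}
    (h : IntervalIntegrable f volume c b) (ha : a ∈ uIcc c b) :
    AbsolutelyContinuousOnInterval (fun x => ∫ t in c..x, f t) a b := by
  have hsub : uIcc a b ⊆ uIcc c b := uIcc_subset_uIcc ha right_mem_uIcc
  have hre : IntervalIntegrable (fun t => (f t).re) volume c b := ⟨h.1.re, h.2.re⟩
  have him : IntervalIntegrable (fun t => (f t).im) volume c b := ⟨h.1.im, h.2.im⟩
  have h1 := (hre.absolutelyContinuousOnInterval_intervalIntegral left_mem_uIcc).mono hsub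
  have h2 := (him.absolutelyContinuousOnInterval_intervalIntegral left_mem_uIcc).mono hsub
  have h3 := (h1.smul (absolutelyContinuous_const (1 : ℂ) a b)).add
    (h2.smul (absolutelyContinuous_const Complex.I a b))
  have e : ∀ x ∈ uIcc a b, ∫ t in c..x, f t =
      ((fun x => ∫ t in c..x, (f t).re) • (fun _ : ℝ => (1 : ℂ)) +
        (fun x => ∫ t in c..x, (f t).im) • (fun _ : ℝ => Complex.I)) x := fun x hx => by
    have hx' : IntervalIntegrable f volume c x :=
      h.mono_set (uIcc_subset_uIcc left_mem_uIcc (hsub hx))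
    simp only [Pi.add_apply, Pi.smul_apply', Complex.real_smul, mul_one]
    have e1 := (Complex.reCLM.intervalIntegral_comp_comm hx')
    have e2 := (Complex.imCLM.intervalIntegral_comp_comm hx')
    simp only [Complex.reCLM_apply, Complex.imCLM_apply] at e1 e2
    rw [e1, e2, Complex.re_add_im]
  rw [absolutelyContinuousOnInterval_iff] at h3 ⊢
  intro ε hε
  obtain ⟨δ, hδ, H⟩ := h3 ε hε
  refine ⟨δ, hδ, fun E hE hlt => lt_of_eq_of_lt (Finset.sum_congr rfl fun i hi => ?_) (H E hE hlt)⟩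
  have := hE.1 i (by simpa using hi)
  rw [e _ this.1, e _ this.2]

lemma exists_mem_Ioo_of_ae {P : ℝ → Prop} (h : ∀ᵐ x ∂halfLine, P x) {a b : ℝ} (ha : 0 ≤ a)
    (hab : a < b) : ∃ x ∈ Ioo a b, P x := by
  rw [ae_restrict_iff' measurableSet_Ioi] at h
  by_contra! hcon
  have : volume (Ioo a b) = 0 := by
    refine measure_mono_null (fun x hx => ?_) h
    exact fun hP => hcon x hx (hP (ha.trans_lt hx.1))
  rw [Real.volume_Ioo] at this
  simp only [ENNReal.ofReal_eq_zero, sub_nonpos] at this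
  linarith

/-! ### The bounded positive inverse and its range -/

namespace GroundState

variable {k : ℕ} {V : ℝ → ℝ} (S : GroundState k V)

/-- The inverse of `𝓛_V`, in the factored form `T* T`. -/
def inverse : HalfLineL2 →L[ℂ] HalfLineL2 := S.isSchurKernel.swap.op ∘L S.isSchurKernel.op

lemma inverse_isPositive : S.inverse.IsPositive := by
  rw [inverse, S.isSchurKernel.op_eq_adjoint S.isSchurKernel.swap fun _ _ => rfl]
  exact ContinuousLinearMap.isPositive_adjoint_comp_self _

/-- `∫₀^r φ g`. -/
def innerIntegral (g : ℝ → ℂ) (r : ℝ) : ℂ := ∫ s in (0 : ℝ)..r, (S.φ s : ℂ) * g s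

/-- `φ⁻¹ ∫₀^r φ g`. -/
def innerQuot (g : ℝ → ℂ) (r : ℝ) : ℂ := ((S.φ r)⁻¹ : ℝ) * S.innerIntegral g r

/-- `∫_r^∞ φ⁻² ∫₀^s φ g`. -/
def outerIntegral (g : ℝ → ℂ) (r : ℝ) : ℂ := ∫ s in Ioi r, ((S.φ s)⁻¹ : ℝ) * S.innerQuot g s

lemma kernelFun_eq_innerQuot (g : ℝ → ℂ) {r : ℝ} (hr : 0 < r) :
    kernelFun halfLine S.kernel g r = S.innerQuot g r := by
  rw [kernelFun, innerQuot, innerIntegral, ← intervalIntegral.integral_const_mul,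
    intervalIntegral.integral_of_le hr.le, integral_Ioc_eq_integral_Ioo,
    ← integral_indicator measurableSet_Ioi, ← integral_indicator measurableSet_Ioo]
  refine integral_congr_ae (Eventually.of_forall fun y => ?_)
  by_cases hy : 0 < y ∧ y < r
  · simp only [indicator_of_mem (show y ∈ Ioi 0 from hy.1),
      indicator_of_mem (show y ∈ Ioo 0 r from hy), kernel, if_pos hy]
    push_cast
    ring
  · simp [indicator, kernel, hy]

lemma intervalIntegrable {g : ℝ → ℂ} (hg : MemLp g 2 halfLine) {b : ℝ} (hb : 0 < b) :
    IntervalIntegrable (fun s => (S.φ s : ℂ) * g s) volume 0 b := by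
  -- Row `x` of the kernel is integrable against `g` for almost every `x`. For one such `x > b` it
  -- equals `φ g / φ(x)` on `(0, b]`.
  obtain ⟨x, hx, hi⟩ := exists_mem_Ioo_of_ae (S.isSchurKernel.ae_integrable hg) hb.le
    (lt_add_one b)
  have hx0 := hb.trans hx.1
  rw [intervalIntegrable_iff_integrableOn_Ioc_of_le hb.le]
  have h1 : IntegrableOn (fun y => (S.kernel x y : ℂ) * g y) (Ioc 0 b) :=
    IntegrableOn.mono_set hi fun y hy => hy.1
  refine IntegrableOn.congr_fun (h1.const_mul (S.φ x : ℂ)) (fun y hy => ?_) measurableSet_Ioc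
  have : (S.φ x : ℂ) ≠ 0 := Complex.ofReal_ne_zero.2 (S.φ_pos hx0).ne'
  simp only [kernel, if_pos (show 0 < y ∧ y < x from ⟨hy.1, hy.2.trans_lt hx.1⟩)]
  push_cast
  field_simp

lemma innerQuot_memLp {g : ℝ → ℂ} (hg : MemLp g 2 halfLine) : MemLp (S.innerQuot g) 2 halfLine := by
  refine (S.isSchurKernel.memLp_kernelFun hg).ae_eq ?_
  filter_upwards [ae_restrict_mem measurableSet_Ioi] with r hr
  exact S.kernelFun_eq_innerQuot g hr

lemma coth_innerQuot_memLp {g : ℝ → ℂ} (hg : MemLp g 2 halfLine) :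
    MemLp (fun r => ((Real.cosh r / Real.sinh r : ℝ) : ℂ) * S.innerQuot g r) 2 halfLine := by
  refine (S.isSchurKernel_coth.memLp_kernelFun hg).ae_eq ?_
  filter_upwards [ae_restrict_mem measurableSet_Ioi] with r hr
  rw [← S.kernelFun_eq_innerQuot g hr, kernelFun, kernelFun, ← integral_const_mul]
  congr 1
  funext y
  push_cast
  ring

lemma integrableOn_outer {g : ℝ → ℂ} (hg : MemLp g 2 halfLine) {r : ℝ} (hr : 0 < r) :
    IntegrableOn (fun s => ((S.φ s)⁻¹ : ℝ) * S.innerQuot g s) (Ioi r) := by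
  -- The same device for a column: for one good `x < r` the column is `φ(x) / φ` on `(r, ∞)`.
  obtain ⟨x, hx, hi⟩ := exists_mem_Ioo_of_ae
    (S.isSchurKernel.swap.ae_integrable (S.innerQuot_memLp hg)) le_rfl hr
  have h1 : IntegrableOn (fun y => (S.kernel y x : ℂ) * S.innerQuot g y) (Ioi r) :=
    IntegrableOn.mono_set hi fun y hy => hr.trans hy
  refine IntegrableOn.congr_fun (h1.const_mul ((S.φ x : ℂ)⁻¹)) (fun y hy => ?_) measurableSet_Ioi
  have : (S.φ x : ℂ) ≠ 0 := Complex.ofReal_ne_zero.2 (S.φ_pos hx.1).ne'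
  simp only [kernel, if_pos (show 0 < x ∧ x < y from ⟨hx.1, hx.2.trans hy⟩)]
  push_cast
  field_simp

lemma kernelFun_swap_eq (g : ℝ → ℂ) {r : ℝ} (hr : 0 < r) :
    kernelFun halfLine (fun x y => S.kernel y x) (S.innerQuot g) r =
      (S.φ r : ℂ) * S.outerIntegral g r := by
  rw [kernelFun, outerIntegral, ← integral_const_mul, ← integral_indicator measurableSet_Ioi,
    ← integral_indicator measurableSet_Ioi]
  refine integral_congr_ae (Eventually.of_forall fun y => ?_)
  by_cases hy : r < y
  · simp only [indicator_of_mem (show y ∈ Ioi r from hy),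
      indicator_of_mem (show y ∈ Ioi 0 from hr.trans hy), kernel,
      if_pos (show 0 < r ∧ r < y from ⟨hr, hy⟩)]
    push_cast
    ring
  · simp [indicator, kernel, hy]

lemma inverse_ae_eq (g : HalfLineL2) :
    S.inverse g =ᵐ[halfLine] fun r => (S.φ r : ℂ) * S.outerIntegral g r := by
  refine (S.isSchurKernel.swap.coeFn_op (S.isSchurKernel.op g)).trans ?_
  have h : S.isSchurKernel.op g =ᵐ[halfLine] S.innerQuot g := by
    filter_upwards [S.isSchurKernel.coeFn_op g, ae_restrict_mem measurableSet_Ioi] with r h hr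
    rw [h, S.kernelFun_eq_innerQuot g hr]
  rw [kernelFun_congr h]
  filter_upwards [ae_restrict_mem measurableSet_Ioi] with r hr
  exact S.kernelFun_swap_eq g hr

lemma continuousOn_φ : ContinuousOn S.φ (Ioi 0) := fun _ hr =>
  (S.hasDerivAt_φ hr).continuousAt.continuousWithinAt

lemma continuousOn_logDeriv : ContinuousOn S.logDeriv (Ioi 0) := fun _ hr =>
  (S.hasDerivAt_logDeriv hr).continuousAt.continuousWithinAt

lemma continuousAt_innerIntegral {g : ℝ → ℂ} (hg : MemLp g 2 halfLine) {r : ℝ} (hr : 0 < r) :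
    ContinuousAt (S.innerIntegral g) r := by
  have h := S.intervalIntegrable hg (b := r + 1) (by linarith)
  have h1 : ContinuousOn (S.innerIntegral g) (uIcc 0 (r + 1)) := by
    apply intervalIntegral.continuousOn_primitive_interval
    rw [uIcc_of_le (by linarith), integrableOn_Icc_iff_integrableOn_Ioc]
    exact (intervalIntegrable_iff_integrableOn_Ioc_of_le (by linarith)).1 h
  refine h1.continuousAt ?_
  rw [uIcc_of_le (by linarith)]
  exact Icc_mem_nhds hr (lt_add_one r)

lemma continuousOn_innerQuot {g : ℝ → ℂ} (hg : MemLp g 2 halfLine) :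
    ContinuousOn (S.innerQuot g) (Ioi 0) := fun _ hr =>
  ((Complex.continuous_ofReal.continuousAt.comp
    ((S.hasDerivAt_φ hr).continuousAt.inv₀ (S.φ_pos hr).ne')).mul
      (S.continuousAt_innerIntegral hg hr)).continuousWithinAt

lemma continuousOn_outer_integrand {g : ℝ → ℂ} (hg : MemLp g 2 halfLine) :
    ContinuousOn (fun s => ((S.φ s)⁻¹ : ℝ) * S.innerQuot g s) (Ioi 0) := fun r hr =>
  ((Complex.continuous_ofReal.continuousAt.comp
    ((S.hasDerivAt_φ hr).continuousAt.inv₀ (S.φ_pos hr).ne')).continuousWithinAt.mul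
      (S.continuousOn_innerQuot hg r hr))

lemma hasDerivAt_outer {g : ℝ → ℂ} (hg : MemLp g 2 halfLine) {r : ℝ} (hr : 0 < r) :
    HasDerivAt (S.outerIntegral g) (-(((S.φ r)⁻¹ : ℝ) * S.innerQuot g r)) r := by
  have hc := S.continuousOn_outer_integrand hg
  have hr2 : 0 < r / 2 := by linarith
  have hi : ∀ b, 0 < b → IntervalIntegrable (fun s => ((S.φ s)⁻¹ : ℝ) * S.innerQuot g s) volume
      (r / 2) b := fun b hb =>
    (hc.mono fun x hx => (lt_min hr2 hb).trans_le hx.1).intervalIntegrable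
  have h1 := intervalIntegral.integral_hasDerivAt_right (hi r hr)
    (hc.stronglyMeasurableAtFilter isOpen_Ioi r hr) (hc.continuousAt (Ioi_mem_nhds hr))
  refine ((h1.const_sub (S.outerIntegral g (r / 2)))).congr_of_eventuallyEq ?_
  filter_upwards [Ioi_mem_nhds hr] with x hx
  rw [outerIntegral, outerIntegral,
    ← intervalIntegral.integral_interval_add_Ioi (S.integrableOn_outer hg hr2)
    (S.integrableOn_outer hg hx)]
  ring

/-- Since `g` is merely `L²`, this is Lebesgue differentiation and holds only almost everywhere, in
contrast to `hasDerivAt_outer`, whose integrand is continuous. -/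
lemma ae_hasDerivAt_innerIntegral {g : ℝ → ℂ} (hg : MemLp g 2 halfLine) :
    ∀ᵐ r ∂halfLine, HasDerivAt (S.innerIntegral g) ((S.φ r : ℂ) * g r) r := by
  rw [ae_restrict_iff' measurableSet_Ioi]
  have h : ∀ n : ℕ, ∀ᵐ r : ℝ, r ∈ uIcc 0 ((n : ℝ) + 1) → ∀ c ∈ uIcc 0 ((n : ℝ) + 1),
      HasDerivAt (fun x => ∫ s in c..x, (S.φ s : ℂ) * g s) ((S.φ r : ℂ) * g r) r := fun n =>
    (S.intervalIntegrable hg (by positivity)).ae_hasDerivAt_integral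
  filter_upwards [ae_all_iff.mpr h] with r hr hr0
  obtain ⟨n, hn⟩ := exists_nat_ge r
  refine hr n ?_ 0 left_mem_uIcc
  rw [uIcc_of_le (by positivity)]
  exact ⟨hr0.le, by linarith⟩

/-- The radial function on `ℍ^{2k+2}` solving `𝓛_V (sinh^{k+1/2} u) = g`. -/
def radialSolution (g : ℝ → ℂ) (r : ℝ) : ℂ :=
  ((S.φ r / weight k r : ℝ) : ℂ) * S.outerIntegral g r

/-- The derivative of `radialSolution`. -/
def radialSolutionDeriv (g : ℝ → ℂ) (r : ℝ) : ℂ :=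
  (((S.logDeriv r - ((k : ℝ) + 1 / 2) * (Real.cosh r / Real.sinh r)) * S.φ r *
      (weight k r)⁻¹ : ℝ) : ℂ) * S.outerIntegral g r
    - (((S.φ r)⁻¹ * (weight k r)⁻¹ : ℝ) : ℂ) * S.innerIntegral g r

lemma conj_radialSolution (g : ℝ → ℂ) {r : ℝ} (hr : 0 < r) :
    conj k (S.radialSolution g) r = (S.φ r : ℂ) * S.outerIntegral g r := by
  have : (weight k r : ℂ) ≠ 0 := Complex.ofReal_ne_zero.2 (weight_pos k hr).ne'
  rw [conj, radialSolution]
  push_cast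
  field_simp

lemma hasDerivAt_inv_weight {r : ℝ} (hr : 0 < r) :
    HasDerivAt (fun r => (weight k r)⁻¹)
      (-(((k : ℝ) + 1 / 2) * (Real.cosh r / Real.sinh r) * (weight k r)⁻¹)) r := by
  have := (weight_pos k hr).ne'
  refine ((hasDerivAt_weight k hr).inv this).congr_deriv ?_
  field_simp

lemma hasDerivAt_inv_φ {r : ℝ} (hr : 0 < r) :
    HasDerivAt (fun r => (S.φ r)⁻¹) (-(S.logDeriv r * (S.φ r)⁻¹)) r := by
  have := (S.φ_pos hr).ne'
  refine ((S.hasDerivAt_φ hr).inv this).congr_deriv ?_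
  field_simp

lemma hasDerivAt_radialSolution {g : ℝ → ℂ} (hg : MemLp g 2 halfLine) {r : ℝ} (hr : 0 < r) :
    HasDerivAt (S.radialSolution g) (S.radialSolutionDeriv g r) r := by
  have h1 := ((S.hasDerivAt_φ hr).mul (hasDerivAt_inv_weight (k := k) hr)).ofReal_comp.mul
    (S.hasDerivAt_outer hg hr)
  have hφ : (S.φ r : ℂ) ≠ 0 := Complex.ofReal_ne_zero.2 (S.φ_pos hr).ne'
  refine h1.congr_deriv ?_
  rw [radialSolutionDeriv, innerQuot]
  simp only [Pi.mul_apply]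
  push_cast
  field_simp
  ring

lemma deriv_radialSolution {g : ℝ → ℂ} (hg : MemLp g 2 halfLine) {r : ℝ} (hr : 0 < r) :
    deriv (S.radialSolution g) r = S.radialSolutionDeriv g r :=
  (S.hasDerivAt_radialSolution hg hr).deriv

lemma continuousOn_coth : ContinuousOn (fun r => Real.cosh r / Real.sinh r) (Ioi 0) :=
  fun _ hr => (hasDerivAt_coth hr).continuousAt.continuousWithinAt

lemma continuousOn_logDeriv_deriv : ContinuousOn (fun r =>
    1 / 4 + ((k : ℝ) ^ 2 - 1 / 4) / Real.sinh r ^ 2 + V r - S.logDeriv r ^ 2) (Ioi 0) := by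
  refine ((continuousOn_const.add (continuousOn_const.div
    (Real.continuous_sinh.continuousOn.pow 2) fun x hx => ?_)).add S.continuousOn).sub
    (S.continuousOn_logDeriv.pow 2)
  exact pow_ne_zero 2 (Real.sinh_pos_iff.mpr hx).ne'

/-- In the formula for `u'` every factor is `C¹` on `(0, ∞)` except `∫₀^r φ g`, which is a primitive
of a locally integrable function. -/
lemma absolutelyContinuous_deriv {g : ℝ → ℂ} (hg : MemLp g 2 halfLine) {a b : ℝ} (ha : 0 < a)
    (hab : a ≤ b) : AbsolutelyContinuousOnInterval (deriv (S.radialSolution g)) a b := by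
  have h1 : AbsolutelyContinuousOnInterval S.logDeriv a b :=
    absolutelyContinuous_of_hasDerivAt ha hab (fun x hx => S.hasDerivAt_logDeriv hx)
      S.continuousOn_logDeriv_deriv
  have h2 : AbsolutelyContinuousOnInterval (fun r => Real.cosh r / Real.sinh r) a b := by
    refine absolutelyContinuous_of_hasDerivAt ha hab (fun x hx => hasDerivAt_coth hx) ?_
    refine (continuousOn_const.div (Real.continuous_sinh.continuousOn.pow 2) fun x hx => ?_).neg
    exact pow_ne_zero 2 (Real.sinh_pos_iff.mpr hx).ne'
  have h3 : AbsolutelyContinuousOnInterval S.φ a b :=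
    absolutelyContinuous_of_hasDerivAt ha hab (fun x hx => S.hasDerivAt_φ hx)
      (S.continuousOn_logDeriv.mul S.continuousOn_φ)
  have h4 : AbsolutelyContinuousOnInterval (fun r => (weight k r)⁻¹) a b :=
    absolutelyContinuous_of_hasDerivAt ha hab (fun x hx => hasDerivAt_inv_weight hx)
      ((continuousOn_const.mul continuousOn_coth).mul fun x hx =>
        (hasDerivAt_inv_weight hx).continuousAt.continuousWithinAt).neg
  have h5 : AbsolutelyContinuousOnInterval (fun r => (S.φ r)⁻¹) a b :=
    absolutelyContinuous_of_hasDerivAt ha hab (fun x hx => S.hasDerivAt_inv_φ hx)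
      (S.continuousOn_logDeriv.mul fun x hx =>
        (S.hasDerivAt_inv_φ hx).continuousAt.continuousWithinAt).neg
  have h6 : AbsolutelyContinuousOnInterval (S.outerIntegral g) a b :=
    absolutelyContinuous_of_hasDerivAt ha hab (fun x hx => S.hasDerivAt_outer hg hx)
      (S.continuousOn_outer_integrand hg).neg
  have h7 : AbsolutelyContinuousOnInterval (S.innerIntegral g) a b := by
    refine absolutelyContinuous_primitive (S.intervalIntegrable hg (ha.trans_le hab)) ?_
    rw [uIcc_of_le (ha.le.trans hab)]
    exact ⟨ha.le, hab⟩
  have h8 := ((((h1.sub (h2.const_mul ((k : ℝ) + 1 / 2))).mul h3).mul h4).smul h6).sub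
    ((h5.mul h4).smul h7)
  refine absolutelyContinuous_congr ha hab (fun r hr => ?_) h8
  rw [S.deriv_radialSolution hg hr, radialSolutionDeriv]
  simp

/-- Let `f = φ · outer` and `I = ∫₀^r φ g`. Then `f' = w f - φ⁻¹ I`. Wherever `I' = φ g`, a second
differentiation gives `f'' = (w' + w²) f - g`, as the two terms in `w φ⁻¹ I` cancel. The Riccati
equation identifies `w' + w²` with the full potential. -/
lemma ae_halfLineExpr_radialSolution {g : ℝ → ℂ} (hg : MemLp g 2 halfLine) :
    ∀ᵐ r ∂halfLine, DifferentiableAt ℝ (deriv (S.radialSolution g)) r ∧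
      halfLineExpr k V (conj k (S.radialSolution g)) r = g r := by
  filter_upwards [S.ae_hasDerivAt_innerIntegral hg, ae_restrict_mem measurableSet_Ioi] with r h hr
  have hr : 0 < r := hr
  have hφ : (S.φ r : ℂ) ≠ 0 := Complex.ofReal_ne_zero.2 (S.φ_pos hr).ne'
  have hlog := S.hasDerivAt_logDeriv hr
  have hout := S.hasDerivAt_outer hg hr
  constructor
  · have h1 := ((((hlog.sub ((hasDerivAt_coth hr).const_mul ((k : ℝ) + 1 / 2))).mul
      (S.hasDerivAt_φ hr)).mul (hasDerivAt_inv_weight (k := k) hr)).ofReal_comp.mul hout).sub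
      (((S.hasDerivAt_inv_φ hr).mul (hasDerivAt_inv_weight (k := k) hr)).ofReal_comp.mul h)
    refine (h1.congr_of_eventuallyEq ?_).differentiableAt
    filter_upwards [Ioi_mem_nhds hr] with x hx
    rw [S.deriv_radialSolution hg hx]
    rfl
  · have e1 : ∀ x, 0 < x → deriv (conj k (S.radialSolution g)) x =
        ((S.logDeriv x * S.φ x : ℝ) : ℂ) * S.outerIntegral g x -
          (((S.φ x)⁻¹ : ℝ) : ℂ) * S.innerIntegral g x := by
      intro x hx
      have h2 := (S.hasDerivAt_φ hx).ofReal_comp.mul (S.hasDerivAt_outer hg hx)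
      have h3 := h2.congr_of_eventuallyEq (f₁ := conj k (S.radialSolution g)) (by
        filter_upwards [Ioi_mem_nhds hx] with y hy using S.conj_radialSolution g hy)
      have hφ : (S.φ x : ℂ) ≠ 0 := Complex.ofReal_ne_zero.2 (S.φ_pos hx).ne'
      rw [h3.deriv, innerQuot]
      push_cast
      field_simp
      ring
    have h4 := ((hlog.mul (S.hasDerivAt_φ hr)).ofReal_comp.mul hout).sub
      ((S.hasDerivAt_inv_φ hr).ofReal_comp.mul h)
    have h5 := h4.congr_of_eventuallyEq (f₁ := deriv (conj k (S.radialSolution g))) (by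
      filter_upwards [Ioi_mem_nhds hr] with y hy using e1 y hy)
    rw [halfLineExpr, h5.deriv, S.conj_radialSolution g hr, innerQuot]
    simp only [Pi.mul_apply]
    push_cast
    field_simp
    ring

/-- After multiplication by the weight, `coth r · u'` is a bounded multiple of `G g` (by `a_sub_le`)
minus `coth r · K g`, which is in `L²` by the second Schur bound. The bound for `u'` follows from
`coth ≥ 1`, and the one for `u''` from solving the equation for it. -/
lemma isRadialH2_radialSolution (hV : MemLp V ⊤ halfLine) (g : HalfLineL2) :
    IsRadialH2 k (S.radialSolution g) := by
  have hg : MemLp g 2 halfLine := Lp.memLp g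
  have h0 : RadialL2 k (S.radialSolution g) := by
    refine (Lp.memLp (S.inverse g)).ae_eq ?_
    filter_upwards [S.inverse_ae_eq g, ae_restrict_mem measurableSet_Ioi] with r h hr
    rw [h, ← S.conj_radialSolution g hr, conj]
  have hcoth : RadialL2 k (fun r => ((Real.cosh r / Real.sinh r : ℝ) : ℂ) *
      deriv (S.radialSolution g) r) := by
    set B : ℝ → ℝ := fun r => Real.cosh r / Real.sinh r *
      (S.logDeriv r - ((k : ℝ) + 1 / 2) * (Real.cosh r / Real.sinh r)) with hB
    have hBm : MemLp B ⊤ halfLine := by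
      refine memLp_top_of_bound (C := S.C) ?_ ?_
      · exact (continuousOn_coth.mul (S.continuousOn_logDeriv.sub
          (continuousOn_const.mul continuousOn_coth))).aestronglyMeasurable measurableSet_Ioi
      · filter_upwards [ae_restrict_mem measurableSet_Ioi] with r hr
        have hs : 0 < Real.sinh r := Real.sinh_pos_iff.mpr hr
        have hch := Real.cosh_pos r
        have e : B r = (S.a r - k * Real.cosh r) * Real.cosh r / Real.sinh r ^ 2 := by
          simp only [hB, GroundState.logDeriv]
          field_simp
          ring
        rw [e, Real.norm_eq_abs, abs_div, abs_mul, abs_of_pos hch,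
          abs_of_pos (by positivity : 0 < Real.sinh r ^ 2), div_le_iff₀ (by positivity)]
        exact S.a_sub_le r hr
    have h1 : MemLp (fun r => (B r : ℂ) * ((weight k r : ℂ) * S.radialSolution g r)) 2 halfLine :=
      MemLp.mul (p := ⊤) (q := 2) h0 hBm.ofReal
    refine (h1.sub (S.coth_innerQuot_memLp hg)).ae_eq ?_
    filter_upwards [ae_restrict_mem measurableSet_Ioi] with r hr
    have hw : (weight k r : ℂ) ≠ 0 := Complex.ofReal_ne_zero.2 (weight_pos k hr).ne'
    rw [S.deriv_radialSolution hg hr, radialSolutionDeriv, Pi.sub_apply, radialSolution,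
      innerQuot, hB]
    push_cast
    field_simp
  have hd : RadialL2 k (deriv (S.radialSolution g)) := by
    refine MemLp.mono hcoth ?_ ?_
    · have hw : ContinuousOn (weight k) (Ioi 0) := fun r hr =>
        (hasDerivAt_weight k hr).continuousAt.continuousWithinAt
      exact ((Complex.continuous_ofReal.comp_continuousOn hw).aestronglyMeasurable
        measurableSet_Ioi).mul (aestronglyMeasurable_deriv _ _)
    · filter_upwards [ae_restrict_mem measurableSet_Ioi] with r hr
      have h1 := one_le_coth hr
      rw [mul_left_comm, norm_mul (((Real.cosh r / Real.sinh r : ℝ) : ℂ)), Complex.norm_real,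
        Real.norm_eq_abs, abs_of_nonneg (zero_le_one.trans h1)]
      exact le_mul_of_one_le_left (norm_nonneg _) h1
  refine ⟨fun r hr => (S.hasDerivAt_radialSolution hg hr).differentiableAt,
    fun a b ha hab => S.absolutelyContinuous_deriv hg ha hab, h0, hd, ?_, hcoth⟩
  have h2 := hcoth.const_mul (2 * k + 1 : ℂ)
  have h3 := h0.const_mul (k * (k + 1) : ℂ)
  have h4 : MemLp (fun r => (V r : ℂ) * ((weight k r : ℂ) * S.radialSolution g r)) 2 halfLine :=
    MemLp.mul (p := ⊤) (q := 2) h0 hV.ofReal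
  refine (((h4.sub hg).sub h2).sub h3).ae_eq ?_
  filter_upwards [S.ae_halfLineExpr_radialSolution hg, ae_restrict_mem measurableSet_Ioi]
    with r h hr
  have h5 := halfLineExpr_conj k V
    (fun x hx => (S.hasDerivAt_radialSolution hg hx).differentiableAt) hr h.1
  rw [h.2] at h5
  simp only [Pi.sub_apply]
  linear_combination (-1 : ℂ) * h5

end GroundState

/-! ### Regularity of eigenfunctions -/

lemma hasDerivAt_primitive {E : Type*} [NormedAddCommGroup E] [NormedSpace ℝ E] [CompleteSpace E]
    {c : ℝ → E} (hc : ContinuousOn c (Ioi 0)) {a r : ℝ} (ha : 0 < a) (hr : 0 < r) :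
    HasDerivAt (fun x => ∫ t in a..x, c t) (c r) r :=
  intervalIntegral.integral_hasDerivAt_right
    ((hc.mono fun _ hx => (lt_min ha hr).trans_le hx.1).intervalIntegrable)
    (hc.stronglyMeasurableAtFilter isOpen_Ioi r hr) (hc.continuousAt (Ioi_mem_nhds hr))

/-- Subtracting a primitive of `c` leaves an absolutely continuous function with derivative zero
almost everywhere, hence a constant. -/
lemma hasDerivAt_of_ae_hasDerivAt {E : Type*} [NormedAddCommGroup E] [NormedSpace ℝ E]
    [CompleteSpace E] {f c : ℝ → E}
    (hf : ∀ a b : ℝ, 0 < a → a ≤ b → AbsolutelyContinuousOnInterval f a b)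
    (hc : ContinuousOn c (Ioi 0)) (h : ∀ᵐ r ∂halfLine, HasDerivAt f (c r) r) {r : ℝ}
    (hr : 0 < r) : HasDerivAt f (c r) r := by
  have ha : 0 < r / 2 := by linarith
  have hab : r / 2 ≤ r + 1 := by linarith
  rw [ae_restrict_iff' measurableSet_Ioi] at h
  have h1 := (hf _ _ ha hab).sub (absolutelyContinuous_of_hasDerivAt ha hab
    (fun x hx => hasDerivAt_primitive hc ha hx) hc)
  obtain ⟨C, hC⟩ := h1.const_of_ae_hasDerivAt_zero (by
    filter_upwards [h] with x hx hmem
    rw [uIcc_of_le hab] at hmem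
    have hx0 : 0 < x := ha.trans_le hmem.1
    simpa using (hx hx0).sub (hasDerivAt_primitive hc ha hx0))
  refine ((hasDerivAt_primitive hc ha hr).const_add C).congr_of_eventuallyEq ?_
  filter_upwards [Icc_mem_nhds (by linarith : r / 2 < r) (lt_add_one r)] with x hx
  rw [← hC x (by rwa [uIcc_of_le hab])]
  simp

/-- A function in the domain with `𝓛_V f = z f` almost everywhere is a classical solution. -/
lemma IsRadialH2.hasDerivAt_deriv_conj {k : ℕ} {u : ℝ → ℂ} (hu : IsRadialH2 k u) {V : ℝ → ℝ}
    (hV : ContinuousOn V (Ioi 0)) {z : ℂ}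
    (h : halfLineExpr k V (conj k u) =ᵐ[halfLine] fun r => z * conj k u r) {r : ℝ} (hr : 0 < r) :
    HasDerivAt (deriv (conj k u))
      ((((1 / 4 + ((k : ℝ) ^ 2 - 1 / 4) / Real.sinh r ^ 2 + V r : ℝ) : ℂ) - z) *
        conj k u r) r := by
  -- The value of `u''` prescribed by the eigenvalue equation. It is continuous because it involves
  -- only `u`, `u'` and continuous coefficients.
  set c : ℝ → ℂ := fun r => - ((2 * k + 1) * (((Real.cosh r / Real.sinh r : ℝ) : ℂ) * deriv u r))
        - k * (k + 1) * u r + (V r : ℂ) * u r - z * u r with hcdef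
  have hcu : ContinuousOn u (Ioi 0) := fun x hx =>
    (hu.differentiableAt x hx).continuousAt.continuousWithinAt
  have hcu' : ContinuousOn (deriv u) (Ioi 0) := fun x hx => by
    have hx : 0 < x := hx
    have h1 := (hu.absolutelyContinuous (x / 2) (x + 1) (by linarith) (by linarith)).continuousOn
    rw [uIcc_of_le (by linarith)] at h1
    exact (h1.continuousAt (Icc_mem_nhds (by linarith) (lt_add_one x))).continuousWithinAt
  have hc : ContinuousOn c (Ioi 0) :=
    ((((continuousOn_const.mul ((Complex.continuous_ofReal.comp_continuousOn
      GroundState.continuousOn_coth).mul hcu')).neg).sub (continuousOn_const.mul hcu)).add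
      ((Complex.continuous_ofReal.comp_continuousOn hV).mul hcu)).sub (continuousOn_const.mul hcu)
  have hae : ∀ᵐ r ∂halfLine, HasDerivAt (deriv u) (c r) r := by
    filter_upwards [h, hu.ae_halfLineExpr V, ae_differentiableAt_deriv hu,
      ae_restrict_mem measurableSet_Ioi] with x h1 h2 h3 hx
    have hw : (weight k x : ℂ) ≠ 0 := Complex.ofReal_ne_zero.2 (weight_pos k hx).ne'
    rw [h1, conj, mul_left_comm] at h2
    have h4 := mul_left_cancel₀ hw h2
    refine h3.hasDerivAt.congr_deriv ?_
    simp only [hcdef]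
    linear_combination h4
  have hdd : ∀ {x : ℝ}, 0 < x → HasDerivAt (deriv u) (c x) x := fun hx =>
    hasDerivAt_of_ae_hasDerivAt hu.absolutelyContinuous hc hae hx
  have hdc : DifferentiableAt ℝ (deriv (conj k u)) r := by
    have h2 := (hasDerivAt_weight k hr).ofReal_comp.mul
      ((((hasDerivAt_coth hr).const_mul ((k : ℝ) + 1 / 2)).ofReal_comp.mul
        (hu.differentiableAt r hr).hasDerivAt).add (hdd hr))
    refine (h2.congr_of_eventuallyEq ?_).differentiableAt
    filter_upwards [Ioi_mem_nhds hr] with x hx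
    exact deriv_conj k hx (hu.differentiableAt x hx)
  refine hdc.hasDerivAt.congr_deriv ?_
  have h5 := halfLineExpr_conj k V hu.differentiableAt hr (hdd hr).differentiableAt
  rw [(hdd hr).deriv, halfLineExpr] at h5
  simp only [hcdef] at h5
  have e : conj k u r = (weight k r : ℂ) * u r := rfl
  linear_combination (-1 : ℂ) * h5 + z * e

lemma IsRadialH2.hasDerivAt_conj {k : ℕ} {u : ℝ → ℂ} (hu : IsRadialH2 k u) {r : ℝ} (hr : 0 < r) :
    HasDerivAt (conj k u) (deriv (conj k u) r) r :=
  ((hasDerivAt_weight k hr).ofReal_comp.mul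
    (hu.differentiableAt r hr).hasDerivAt).differentiableAt.hasDerivAt

lemma IsRadialH2.memLp_deriv_conj {k : ℕ} {u : ℝ → ℂ} (hu : IsRadialH2 k u) {r₀ : ℝ}
    (hr₀ : 0 < r₀) : MemLp (deriv (conj k u)) 2 (volume.restrict (Ioi r₀)) := by
  have hle : volume.restrict (Ioi r₀) ≤ halfLine :=
    Measure.restrict_mono (Ioi_subset_Ioi hr₀.le) le_rfl
  have hB : MemLp (fun r => ((k : ℝ) + 1 / 2) * (Real.cosh r / Real.sinh r)) ⊤
      (volume.restrict (Ioi r₀)) := by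
    refine memLp_top_of_bound (C := ((k : ℝ) + 1 / 2) * (Real.cosh r₀ / Real.sinh r₀)) ?_ ?_
    · exact ((continuousOn_const.mul GroundState.continuousOn_coth).mono
        (Ioi_subset_Ioi hr₀.le)).aestronglyMeasurable measurableSet_Ioi
    · filter_upwards [ae_restrict_mem measurableSet_Ioi] with r hr
      have hr : r₀ < r := hr
      have h1 : 0 < Real.sinh r₀ := Real.sinh_pos_iff.mpr hr₀
      have h2 : 0 < Real.sinh r := Real.sinh_pos_iff.mpr (hr₀.trans hr)
      have h3 := Real.cosh_pos r
      rw [Real.norm_eq_abs, abs_of_nonneg (by positivity)]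
      gcongr ((k : ℝ) + 1 / 2) * ?_
      rw [div_le_div_iff₀ h2 h1]
      -- The inequality `coth r ≤ coth r₀` is `sinh (r - r₀) ≥ 0` expanded.
      have := Real.sinh_sub r r₀
      have h4 : 0 < Real.sinh (r - r₀) := Real.sinh_pos_iff.mpr (by linarith)
      linarith
  have h1 : MemLp (fun r => (((((k : ℝ) + 1 / 2) * (Real.cosh r / Real.sinh r) : ℝ)) : ℂ) *
      ((weight k r : ℂ) * u r)) 2 (volume.restrict (Ioi r₀)) :=
    MemLp.mul (p := ⊤) (q := 2) (hu.radialL2.mono_measure hle) hB.ofReal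
  refine (h1.add (hu.radialL2_deriv.mono_measure hle)).ae_eq ?_
  filter_upwards [ae_restrict_mem measurableSet_Ioi] with r hr
  have hr : 0 < r := hr₀.trans hr
  rw [deriv_conj k hr (hu.differentiableAt r hr), Pi.add_apply]
  ring

/-! ### Solutions in `L²` -/

lemma not_integrableOn_Ioi_of_le {F : ℝ → ℝ} {a c : ℝ} (hc : 0 < c) (h : ∀ x, a < x → c ≤ F x) :
    ¬ IntegrableOn F (Ioi a) := fun hF => by
  have h1 : IntegrableOn (fun _ : ℝ => c) (Ioi a) := by
    refine Integrable.mono hF aestronglyMeasurable_const ?_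
    filter_upwards [ae_restrict_mem measurableSet_Ioi] with x hx
    rw [Real.norm_eq_abs, Real.norm_eq_abs, abs_of_pos hc]
    exact (h x hx).trans (le_abs_self _)
  rw [integrableOn_const_iff] at h1
  simp [hc.ne'] at h1

lemma memLp_two_sq {α : Type*} [MeasurableSpace α] {μ : Measure α} {f : α → ℂ}
    (hf : MemLp f 2 μ) : Integrable (fun x => ‖f x‖ ^ 2) μ := by
  simpa using hf.integrable_norm_rpow two_ne_zero ENNReal.ofNat_ne_top

lemma MemLp.integrable_real_inner {α : Type*} [MeasurableSpace α] {μ : Measure α} {f g : α → ℂ}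
    (hf : MemLp f 2 μ) (hg : MemLp g 2 μ) : Integrable (fun x => inner ℝ (f x) (g x)) μ := by
  refine ((memLp_two_sq hf).add (memLp_two_sq hg)).mono
    (hf.aestronglyMeasurable.inner hg.aestronglyMeasurable) (Eventually.of_forall fun x => ?_)
  rw [Pi.add_apply, Real.norm_eq_abs, Real.norm_eq_abs,
    abs_of_nonneg (by positivity : 0 ≤ ‖f x‖ ^ 2 + ‖g x‖ ^ 2)]
  have := abs_real_inner_le_norm (f x) (g x)
  nlinarith [sq_nonneg (‖f x‖ - ‖g x‖), norm_nonneg (f x), norm_nonneg (g x)]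

/-- A Gronwall lower bound. -/
lemma exp_mul_le_of_deriv_ge {N N' : ℝ → ℝ} {r₀ D m : ℝ} (hD : 0 ≤ D)
    (hN : ∀ r, r₀ ≤ r → HasDerivAt N (N' r) r)
    (h : ∀ r, r₀ ≤ r → -((D * Real.exp (-r / 2) + m) * N r) ≤ N' r) (h0 : 0 < N r₀) :
    ∃ c, 0 < c ∧ ∀ r, r₀ ≤ r → c ≤ Real.exp (m * r) * N r := by
  -- Integrating factor: `β' / β = m + D e^{-r/2}`. The second term has a finite integral, so it
  -- costs only a constant, and `β ≤ e^{m r}`.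
  set β : ℝ → ℝ := fun r => Real.exp (m * r - 2 * D * Real.exp (-r / 2)) with hβ
  have hβd : ∀ r, HasDerivAt β (β r * (m + D * Real.exp (-r / 2))) r := fun r => by
    have h1 : HasDerivAt (fun r : ℝ => Real.exp (-r / 2)) (Real.exp (-r / 2) * (-1 / 2)) r :=
      ((hasDerivAt_id r).neg.div_const 2).exp
    refine ((((hasDerivAt_id r).const_mul m).sub (h1.const_mul (2 * D))).exp).congr_deriv ?_
    simp only [hβ, id, Pi.sub_apply]
    ring
  have hmono : MonotoneOn (fun r => β r * N r) (Ici r₀) := by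
    refine monotoneOn_of_hasDerivWithinAt_nonneg (convex_Ici r₀)
      (f' := fun r => β r * (m + D * Real.exp (-r / 2)) * N r + β r * N' r) ?_ ?_ ?_
    · exact fun r hr => ((hβd r).mul (hN r hr)).continuousAt.continuousWithinAt
    · intro r hr
      rw [interior_Ici] at hr
      exact ((hβd r).mul (hN r hr.le)).hasDerivWithinAt
    · intro r hr
      rw [interior_Ici] at hr
      have h1 := h r hr.le
      have h2 : 0 < β r := Real.exp_pos _
      nlinarith
  refine ⟨β r₀ * N r₀, mul_pos (Real.exp_pos _) h0, fun r hr => ?_⟩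
  have h1 := hmono self_mem_Ici hr hr
  have h0' : 0 < β r₀ * N r₀ := mul_pos (Real.exp_pos _) h0
  have h2 : 0 < N r := by
    have h3 : 0 < β r := Real.exp_pos _
    exact pos_of_mul_pos_right (h0'.trans_le h1) h3.le
  refine h1.trans (mul_le_mul_of_nonneg_right ?_ h2.le)
  apply Real.exp_le_exp.2
  have := Real.exp_pos (-r / 2)
  nlinarith [mul_nonneg hD this.le]

/-- If `q = O(e^{-2r})` and `E ≥ 0`, then `f'' = (q - E) f` has no nonzero solution with
`f, f' ∈ L²` near infinity. -/
lemma eq_zero_of_memLp_of_decay {f f' : ℝ → ℂ} {q : ℝ → ℝ} {E B r₀ : ℝ} (hr₀ : 0 < r₀)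
    (hE : 0 ≤ E) (hB : 0 ≤ B) (hf : ∀ r, r₀ ≤ r → HasDerivAt f (f' r) r)
    (hf' : ∀ r, r₀ ≤ r → HasDerivAt f' (((q r - E : ℝ) : ℂ) * f r) r)
    (hqc : ContinuousOn q (Ioi 0)) (hq : ∀ r, r₀ ≤ r → |q r| ≤ B * Real.exp (-2 * r))
    (hL : MemLp f 2 (volume.restrict (Ioi r₀))) (hL' : MemLp f' 2 (volume.restrict (Ioi r₀))) :
    f r₀ = 0 := by
  by_contra hne
  -- The energy `|f'|² + E |f|²`, with `e^{-r}` added so that it stays coercive when `E = 0`. In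
  -- `N'` the terms with `E` cancel. The cross term is `O(e^{-r}) |f| |f'|`, and `2 e^{-r/2} |f|
  -- |f'| ≤ N` turns it into an integrable multiple of `N`.
  set N : ℝ → ℝ := fun r => ‖f' r‖ ^ 2 + (E + Real.exp (-r)) * ‖f r‖ ^ 2 with hNdef
  have hN0 : 0 < N r₀ := by
    have h1 : 0 < ‖f r₀‖ := norm_pos_iff.2 hne
    have h2 := Real.exp_pos (-r₀)
    simp only [hNdef]
    positivity
  have hNd : ∀ r, r₀ ≤ r → HasDerivAt N
      (2 * (q r + Real.exp (-r)) * inner ℝ (f r) (f' r) - Real.exp (-r) * ‖f r‖ ^ 2) r := by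
    intro r hr
    have h1 : HasDerivAt (fun r : ℝ => E + Real.exp (-r)) (Real.exp (-r) * (-1)) r :=
      ((hasDerivAt_id r).neg.exp).const_add E
    refine ((hf' r hr).norm_sq.add (h1.mul (hf r hr).norm_sq)).congr_deriv ?_
    rw [← Complex.real_smul, inner_smul_right, real_inner_comm]
    ring
  have hNn : ∀ r, 0 ≤ N r := fun r => by
    have := Real.exp_pos (-r)
    simp only [hNdef]
    positivity
  have hmain : ∀ r, r₀ ≤ r → -(((B + 1) * Real.exp (-r / 2)) * N r) - Real.exp (-r) * ‖f r‖ ^ 2 ≤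
      2 * (q r + Real.exp (-r)) * inner ℝ (f r) (f' r) - Real.exp (-r) * ‖f r‖ ^ 2 := by
    intro r hr
    have he : Real.exp (-r) = Real.exp (-r / 2) ^ 2 := by
      rw [← Real.exp_nat_mul]
      ring_nf
    have he2 : Real.exp (-2 * r) ≤ Real.exp (-r) := Real.exp_le_exp.2 (by linarith)
    have h1 : |q r + Real.exp (-r)| ≤ (B + 1) * Real.exp (-r / 2) ^ 2 := by
      refine (abs_add_le _ _).trans ?_
      rw [abs_of_pos (Real.exp_pos _), ← he]
      have := hq r hr
      nlinarith
    have h2 := abs_real_inner_le_norm (f r) (f' r)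
    have hx := Real.exp_pos (-r / 2)
    have h3 : 2 * Real.exp (-r / 2) * (‖f r‖ * ‖f' r‖) ≤ N r := by
      simp only [hNdef]
      rw [he]
      nlinarith [sq_nonneg (Real.exp (-r / 2) * ‖f r‖ - ‖f' r‖), mul_nonneg hE (sq_nonneg ‖f r‖)]
    have h4 : |2 * (q r + Real.exp (-r)) * inner ℝ (f r) (f' r)| ≤
        (B + 1) * Real.exp (-r / 2) * N r := by
      rw [abs_mul, abs_mul, abs_two]
      calc 2 * |q r + Real.exp (-r)| * |inner ℝ (f r) (f' r)|
          ≤ 2 * ((B + 1) * Real.exp (-r / 2) ^ 2) * (‖f r‖ * ‖f' r‖) := by gcongr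
        _ = (B + 1) * Real.exp (-r / 2) * (2 * Real.exp (-r / 2) * (‖f r‖ * ‖f' r‖)) := by ring
        _ ≤ _ := by gcongr
    have := neg_le_of_abs_le h4
    linarith
  have hi := memLp_two_sq hL
  have hi' := memLp_two_sq hL'
  rcases hE.eq_or_lt with rfl | hE
  -- Case `E = 0`. Only `e^{-r} |f|² ≤ N` is available, so Gronwall gives the weaker bound `e^r N ≥
  -- c`. It is contradicted by showing that `f → 0` and `f' = O(e^{-2r})`, whence `e^r N = e^r |f'|²
  -- + |f|² → 0`.
  · obtain ⟨c, hc, hcN⟩ := exp_mul_le_of_deriv_ge (m := 1) (by linarith : 0 ≤ B + 1) hNd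
      (fun r hr => by
        refine le_trans ?_ (hmain r hr)
        have : Real.exp (-r) * ‖f r‖ ^ 2 ≤ N r := by
          simp only [hNdef]
          nlinarith [sq_nonneg ‖f' r‖]
        linarith) hN0
    have hsub : Ioi r₀ ⊆ Ioi 0 := Ioi_subset_Ioi hr₀.le
    have hf'' : MemLp (fun r => ((q r - 0 : ℝ) : ℂ) * f r) 2 (volume.restrict (Ioi r₀)) := by
      have hqb : MemLp (fun r => q r - 0) ⊤ (volume.restrict (Ioi r₀)) := by
        refine memLp_top_of_bound (C := B) ((hqc.mono hsub).sub
          continuousOn_const |>.aestronglyMeasurable measurableSet_Ioi) ?_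
        filter_upwards [ae_restrict_mem measurableSet_Ioi] with r hr
        have h1 : r₀ < r := hr
        rw [sub_zero, Real.norm_eq_abs]
        refine (hq r h1.le).trans (mul_le_of_le_one_right hB ?_)
        exact Real.exp_le_one_iff.2 (by linarith)
      exact MemLp.mul (p := ⊤) (q := 2) hL hqb.ofReal
    -- An integrable function with integrable derivative tends to zero.
    have ht : Tendsto (fun r => ‖f r‖ ^ 2) atTop (𝓝 0) :=
      tendsto_zero_of_hasDerivAt_of_integrableOn_Ioi (a := r₀)
        (fun r hr => (hf r (le_of_lt hr)).norm_sq)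
        ((MemLp.integrable_real_inner hL hL').const_mul 2) hi
    have ht' : Tendsto (fun r => ‖f' r‖ ^ 2) atTop (𝓝 0) :=
      tendsto_zero_of_hasDerivAt_of_integrableOn_Ioi (a := r₀)
        (fun r hr => (hf' r (le_of_lt hr)).norm_sq)
        ((MemLp.integrable_real_inner hL' hf'').const_mul 2) hi'
    have htf' : Tendsto f' atTop (𝓝 0) := by
      rw [tendsto_zero_iff_norm_tendsto_zero]
      simpa [Function.comp_def] using (Real.continuous_sqrt.tendsto 0).comp ht'
    obtain ⟨r₁, hr₁⟩ := eventually_atTop.1 (ht.eventually (ge_mem_nhds one_pos))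
    have hexp : ∀ r : ℝ, IntegrableOn (fun s => B * Real.exp (-2 * s)) (Ioi r) := fun r =>
      (exp_neg_integrableOn_Ioi r two_pos).const_mul B
    -- Integrate `f'' = q f` from infinity, where `f'` vanishes, using `|f| ≤ 1` beyond `r₁`.
    have hbound : ∀ r, max r₀ r₁ ≤ r → ‖f' r‖ ≤ B * Real.exp (-2 * r) := by
      intro r hr
      have hrr := (le_max_left _ _).trans hr
      have hle : ∀ s ∈ Ioi r, ‖((q s - 0 : ℝ) : ℂ) * f s‖ ≤ B * Real.exp (-2 * s) := by
        intro s hs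
        have hs : r < s := hs
        have h1 : ‖f s‖ ^ 2 ≤ 1 := hr₁ s (((le_max_right _ _).trans hr).trans hs.le)
        have h2 : ‖f s‖ ≤ 1 := by nlinarith [norm_nonneg (f s)]
        rw [norm_mul, Complex.norm_real, sub_zero, Real.norm_eq_abs]
        exact (mul_le_of_le_one_right (abs_nonneg _) h2).trans (hq s (hrr.trans hs.le))
      have hint : IntegrableOn (fun s => ((q s - 0 : ℝ) : ℂ) * f s) (Ioi r) := by
        refine Integrable.mono' (hexp r) ?_ ?_
        · exact hf''.aestronglyMeasurable.mono_measure
            (Measure.restrict_mono (Ioi_subset_Ioi hrr) le_rfl)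
        · exact (ae_restrict_iff' measurableSet_Ioi).2 (Eventually.of_forall hle)
      have h3 := integral_Ioi_of_hasDerivAt_of_tendsto'
        (fun s hs => hf' s (hrr.trans hs)) hint htf'
      have h4 : ‖f' r‖ = ‖∫ s in Ioi r, ((q s - 0 : ℝ) : ℂ) * f s‖ := by
        rw [h3, zero_sub, norm_neg]
      rw [h4]
      refine (norm_integral_le_of_norm_le (hexp r)
        ((ae_restrict_iff' measurableSet_Ioi).2 (Eventually.of_forall hle))).trans ?_
      rw [integral_const_mul, integral_exp_mul_Ioi (by norm_num)]
      have := Real.exp_pos (-2 * r)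
      refine mul_le_mul_of_nonneg_left ?_ hB
      linarith
    have hlim : Tendsto (fun r => B ^ 2 * Real.exp (-r) + ‖f r‖ ^ 2) atTop (𝓝 0) := by
      simpa using ((Real.tendsto_exp_neg_atTop_nhds_zero).const_mul (B ^ 2)).add ht
    obtain ⟨r, hr1, hr2⟩ := ((hlim.eventually (gt_mem_nhds hc)).and
      (eventually_ge_atTop (max r₀ r₁))).exists
    have hrr := (le_max_left _ _).trans hr2
    have h5 := hcN r hrr
    have h6 := hbound r hr2
    have h7 : Real.exp (1 * r) * N r = Real.exp r * ‖f' r‖ ^ 2 + ‖f r‖ ^ 2 := by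
      have : Real.exp r * Real.exp (-r) = 1 := by rw [← Real.exp_add]; simp
      simp only [hNdef, one_mul, zero_add]
      linear_combination ‖f r‖ ^ 2 * this
    have h8 : Real.exp r * ‖f' r‖ ^ 2 ≤ B ^ 2 * Real.exp (-r) := by
      calc Real.exp r * ‖f' r‖ ^ 2 ≤ Real.exp r * (B * Real.exp (-2 * r)) ^ 2 := by gcongr
        _ = B ^ 2 * Real.exp (-3 * r) := by
          rw [mul_pow, ← Real.exp_nat_mul, mul_left_comm, ← Real.exp_add]
          ring_nf
        _ ≤ B ^ 2 * Real.exp (-r) := by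
          gcongr
          linarith
    linarith
  -- Case `E > 0`. Now `|f|² ≤ N / E`, so the term `e^{-r} |f|²` is also an integrable multiple of
  -- `N`, and `N` stays above a positive constant. But `N ≤ |f'|² + (E + 1) |f|²` is integrable.
  · obtain ⟨c, hc, hcN⟩ := exp_mul_le_of_deriv_ge (m := 0) (by positivity : 0 ≤ B + 1 + 1 / E) hNd
      (fun r hr => by
        refine le_trans ?_ (hmain r hr)
        have h1 : E * ‖f r‖ ^ 2 ≤ N r := by
          simp only [hNdef]
          nlinarith [sq_nonneg ‖f' r‖, mul_nonneg (Real.exp_pos (-r)).le (sq_nonneg ‖f r‖)]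
        have h2 : ‖f r‖ ^ 2 ≤ 1 / E * N r := by
          rw [div_mul_eq_mul_div, one_mul, le_div_iff₀ hE]
          linarith
        have h3 : Real.exp (-r) ≤ Real.exp (-r / 2) := Real.exp_le_exp.2 (by linarith)
        have h4 : Real.exp (-r) * ‖f r‖ ^ 2 ≤ Real.exp (-r / 2) * (1 / E * N r) := by gcongr
        linarith) hN0
    have hint : IntegrableOn (fun r => ‖f' r‖ ^ 2 + (E + 1) * ‖f r‖ ^ 2) (Ioi r₀) :=
      Integrable.add hi' (hi.const_mul (E + 1))
    refine not_integrableOn_Ioi_of_le hc (fun r hr => ?_) hint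
    have h1 := hcN r hr.le
    rw [zero_mul, Real.exp_zero, one_mul] at h1
    refine h1.trans ?_
    simp only [hNdef]
    have : Real.exp (-r) ≤ 1 := Real.exp_le_one_iff.2 (by linarith)
    gcongr

namespace GroundState

variable {k : ℕ} {V : ℝ → ℝ} (S : GroundState k V) (hV : MemLp V ⊤ halfLine)

/-! ### Zero is not an eigenvalue -/

/-- The singular parts of `(k + 1/2) coth r` and `w` cancel at the origin, so `(∂ - w)` maps the
domain into `L²` although the two terms need not be in `L²` separately. -/
lemma memLp_deriv_conj_sub {u : ℝ → ℂ} (hu : IsRadialH2 k u) :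
    MemLp (fun r => deriv (conj k u) r - (S.logDeriv r : ℂ) * conj k u r) 2 halfLine := by
  set B : ℝ → ℝ := fun r => ((k : ℝ) + 1 / 2) * (Real.cosh r / Real.sinh r) - S.logDeriv r with hB
  have hBm : MemLp B ⊤ halfLine := by
    refine memLp_top_of_bound (C := S.C) ?_ ?_
    · exact ((continuousOn_const.mul continuousOn_coth).sub
        S.continuousOn_logDeriv).aestronglyMeasurable measurableSet_Ioi
    · filter_upwards [ae_restrict_mem measurableSet_Ioi] with r hr
      have hs : 0 < Real.sinh r := Real.sinh_pos_iff.mpr hr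
      have e : B r = -((S.a r - k * Real.cosh r) / Real.sinh r) := by
        simp only [hB, GroundState.logDeriv]
        field_simp
        ring
      rw [e, norm_neg, Real.norm_eq_abs, abs_div, abs_of_pos hs, div_le_iff₀ hs]
      have h1 := S.a_sub_le r hr
      have h2 := (Real.sinh_lt_cosh r).le
      have h3 := mul_le_mul_of_nonneg_left h2 (abs_nonneg (S.a r - k * Real.cosh r))
      refine le_of_mul_le_mul_right ?_ hs
      linarith
  have h1 : MemLp (fun r => (B r : ℂ) * ((weight k r : ℂ) * u r)) 2 halfLine :=
    MemLp.mul (p := ⊤) (q := 2) hu.radialL2 hBm.ofReal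
  refine (h1.add hu.radialL2_deriv).ae_eq ?_
  filter_upwards [ae_restrict_mem measurableSet_Ioi] with r hr
  rw [deriv_conj k hr (hu.differentiableAt r hr), Pi.add_apply, conj, hB]
  push_cast
  ring

lemma eq_const_of_hasDerivAt_zero {f : ℝ → ℂ} (h : ∀ r, 0 < r → HasDerivAt f 0 r) {r : ℝ}
    (hr : 0 < r) : f r = f 1 :=
  isOpen_Ioi.is_const_of_deriv_eq_zero isPreconnected_Ioi
    (fun x hx => (h x hx).differentiableAt.differentiableWithinAt)
    (fun x hx => (h x hx).deriv) hr (mem_Ioi.2 one_pos)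

/-- `φ⁻¹` is not square integrable near the origin. -/
lemma not_memLp_inv_φ : ¬ MemLp (fun r => ((S.φ r)⁻¹ : ℂ)) 2 halfLine := fun h => by
  have h1 : IntegrableOn (fun r => ‖((S.φ r)⁻¹ : ℂ)‖ ^ 2) (Ioc 0 1) :=
    IntegrableOn.mono_set (memLp_two_sq h) Ioc_subset_Ioi_self
  have hC : 0 < S.C := (S.pos 1 one_pos).trans_le (S.le_const 1 one_pos)
  have hch := Real.cosh_pos 1
  -- On `(0, 1]` one has `φ² = sinh r · ψ² ≤ cosh 1 · C² r`, so integrability of `φ⁻²` would force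
  -- that of `1/r`.
  have h2 : IntegrableOn (fun r : ℝ => r⁻¹) (Ioc 0 1) := by
    refine Integrable.mono' (h1.const_mul (Real.cosh 1 * S.C ^ 2))
      measurable_inv.aestronglyMeasurable ?_
    filter_upwards [ae_restrict_mem measurableSet_Ioc] with r hr
    have hr0 : 0 < r := hr.1
    have hs : 0 < Real.sinh r := Real.sinh_pos_iff.mpr hr0
    have hp := S.pos r hr0
    have h3 : Real.sinh r ≤ Real.cosh 1 * r := by
      obtain ⟨c, hc, he⟩ := exists_hasDerivAt_eq_slope Real.sinh Real.cosh hr0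
        Real.continuous_sinh.continuousOn fun x _ => Real.hasDerivAt_sinh x
      rw [Real.sinh_zero, sub_zero, sub_zero, eq_div_iff hr0.ne'] at he
      rw [← he]
      gcongr
      rw [Real.cosh_le_cosh, abs_of_pos hc.1, abs_one]
      exact hc.2.le.trans hr.2
    rw [Real.norm_eq_abs, abs_of_pos (inv_pos.2 hr0), norm_inv, Complex.norm_real,
      Real.norm_eq_abs, abs_of_pos (S.φ_pos hr0), inv_pow, ← div_eq_mul_inv, inv_eq_one_div,
      div_le_div_iff₀ hr0 (by have := S.φ_pos hr0; positivity), φ, mul_pow, Real.sq_sqrt hs.le]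
    have h4 : S.ψ r ^ 2 ≤ S.C ^ 2 := by
      have := S.le_const r hr0
      gcongr
    calc 1 * (Real.sinh r * S.ψ r ^ 2) ≤ 1 * ((Real.cosh 1 * r) * S.C ^ 2) := by gcongr
      _ = _ := by ring
  rw [← intervalIntegrable_iff_integrableOn_Ioc_of_le zero_le_one,
    intervalIntegrable_inv_iff] at h2
  simp at h2

/-- `φ` is not square integrable at infinity. -/
lemma not_memLp_φ : ¬ MemLp (fun r => (S.φ r : ℂ)) 2 halfLine := fun h => by
  have h1 : IntegrableOn (fun r => ‖(S.φ r : ℂ)‖ ^ 2) (Ioi 1) :=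
    IntegrableOn.mono_set (memLp_two_sq h) (Ioi_subset_Ioi zero_le_one)
  have hC : 0 < S.C := (S.pos 1 one_pos).trans_le (S.le_const 1 one_pos)
  have hp := S.pos 1 one_pos
  have hs1 : 0 < Real.sinh 1 := Real.sinh_pos_iff.mpr one_pos
  refine not_integrableOn_Ioi_of_le (c := Real.sinh 1 * (S.ψ 1 / S.C) ^ 2) (by positivity)
    (fun r hr => ?_) h1
  have hr0 : 0 < r := one_pos.trans hr
  rw [Complex.norm_real, Real.norm_eq_abs, sq_abs, φ, mul_pow,
    Real.sq_sqrt (Real.sinh_pos_iff.mpr hr0).le]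
  have h2 : S.ψ 1 / S.C ≤ S.ψ r := by
    rw [div_le_iff₀ hC, mul_comm]
    exact S.le_mul 1 r one_pos hr.le
  have h3 : Real.sinh 1 ≤ Real.sinh r := Real.sinh_le_sinh.2 hr.le
  gcongr

/-- The Wronskian `W = φ (f' - w f)` of `φ` and `f` is constant. If it were nonzero, `φ⁻¹` would be
a multiple of `f' - w f`, which is in `L²`. So `W = 0` and `f` is a multiple of `φ`, which is not in
`L²` unless the multiple is zero. -/
lemma conj_eq_zero_of_halfLineExpr (S : GroundState k V) {u : ℝ → ℂ} (hu : IsRadialH2 k u)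
    (h : halfLineExpr k V (conj k u) =ᵐ[halfLine] fun r => (0 : ℂ) * conj k u r) {r : ℝ}
    (hr : 0 < r) : conj k u r = 0 := by
  have hd : ∀ {x : ℝ}, 0 < x → _ := fun hx => hu.hasDerivAt_deriv_conj S.continuousOn h hx
  have hφ0 : ∀ {x : ℝ}, 0 < x → (S.φ x : ℂ) ≠ 0 := fun hx =>
    Complex.ofReal_ne_zero.2 (S.φ_pos hx).ne'
  set W : ℝ → ℂ := fun x => (S.φ x : ℂ) *
    (deriv (conj k u) x - (S.logDeriv x : ℂ) * conj k u x) with hW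
  have hWd : ∀ x, 0 < x → HasDerivAt W 0 x := fun x hx => by
    refine ((S.hasDerivAt_φ hx).ofReal_comp.mul ((hd hx).sub
      ((S.hasDerivAt_logDeriv hx).ofReal_comp.mul (hu.hasDerivAt_conj hx)))).congr_deriv ?_
    simp only [Pi.sub_apply, Pi.mul_apply]
    push_cast
    ring
  have hW1 : W 1 = 0 := by
    by_contra hne
    refine S.not_memLp_inv_φ (((S.memLp_deriv_conj_sub hu).const_mul (W 1)⁻¹).ae_eq ?_)
    filter_upwards [ae_restrict_mem measurableSet_Ioi] with x hx
    have e := eq_const_of_hasDerivAt_zero hWd hx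
    have := hφ0 hx
    rw [← e] at hne ⊢
    simp only [hW] at hne ⊢
    have h2 := right_ne_zero_of_mul hne
    field_simp
  have hqd : ∀ x, 0 < x → HasDerivAt (fun x => conj k u x * (((S.φ x)⁻¹ : ℝ) : ℂ)) 0 x :=
    fun x hx => by
    have e := (eq_const_of_hasDerivAt_zero hWd hx).trans hW1
    have e2 := (mul_eq_zero.1 e).resolve_left (hφ0 hx)
    refine ((hu.hasDerivAt_conj hx).mul (S.hasDerivAt_inv_φ hx).ofReal_comp).congr_deriv ?_
    push_cast
    linear_combination ((S.φ x : ℂ)⁻¹) * e2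
  have hq : ∀ {x : ℝ}, 0 < x → conj k u x = conj k u 1 * (((S.φ 1)⁻¹ : ℝ) : ℂ) * S.φ x :=
    fun hx => by
    rw [← eq_const_of_hasDerivAt_zero hqd hx]
    have := hφ0 hx
    push_cast
    field_simp
  by_contra hne
  rw [hq hr] at hne
  set c := conj k u 1 * (((S.φ 1)⁻¹ : ℝ) : ℂ)
  have hc : c ≠ 0 := left_ne_zero_of_mul hne
  refine S.not_memLp_φ ((hu.radialL2.const_mul c⁻¹).ae_eq ?_)
  filter_upwards [ae_restrict_mem measurableSet_Ioi] with x hx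
  have h1 : (weight k x : ℂ) * u x = c * S.φ x := hq hx
  rw [h1, inv_mul_cancel_left₀ hc]

/-! ### No eigenvalue in `[1/4, ∞)` -/

lemma conj_eq_zero_of_quarter_le (S : GroundState k V) {u : ℝ → ℂ} (hu : IsRadialH2 k u)
    {m : ℝ} (hm : 1 / 4 ≤ m)
    (h : halfLineExpr k V (conj k u) =ᵐ[halfLine] fun r => (m : ℂ) * conj k u r) {r : ℝ}
    (hr : 0 < r) : conj k u r = 0 := by
  set q : ℝ → ℝ := fun r => ((k : ℝ) ^ 2 - 1 / 4) / Real.sinh r ^ 2 + V r with hq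
  have hle : volume.restrict (Ioi r) ≤ halfLine :=
    Measure.restrict_mono (Ioi_subset_Ioi hr.le) le_rfl
  set A := |(k : ℝ) ^ 2 - 1 / 4| + S.C with hA
  have hA0 : 0 ≤ A := add_nonneg (abs_nonneg _) S.C_nonneg
  have hr2 : 0 < 1 - Real.exp (-2 * r) := by
    have : Real.exp (-2 * r) < Real.exp 0 := Real.exp_lt_exp.2 (by linarith)
    rw [Real.exp_zero] at this
    linarith
  -- The starting point of the decay lemma is the arbitrary `r` itself. The constant `B` comes from
  -- `sinh x ≥ e^x (1 - e^{-2r}) / 2` for `x ≥ r`.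
  refine eq_zero_of_memLp_of_decay (q := q) (E := m - 1 / 4)
    (B := A * 4 / (1 - Real.exp (-2 * r)) ^ 2) hr (by linarith) (by positivity)
    (fun x hx => hu.hasDerivAt_conj (hr.trans_le hx)) (fun x hx => ?_) ?_ (fun x hx => ?_)
    (hu.radialL2.mono_measure hle) (hu.memLp_deriv_conj hr)
  · refine (hu.hasDerivAt_deriv_conj S.continuousOn h (hr.trans_le hx)).congr_deriv ?_
    simp only [hq]
    push_cast
    ring
  · exact (continuousOn_const.div (Real.continuous_sinh.continuousOn.pow 2) fun x hx =>
      pow_ne_zero 2 (Real.sinh_pos_iff.mpr hx).ne').add S.continuousOn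
  · have hx0 := hr.trans_le hx
    have hs : 0 < Real.sinh x := Real.sinh_pos_iff.mpr hx0
    have h1 : |q x| ≤ A / Real.sinh x ^ 2 := by
      rw [le_div_iff₀ (by positivity)]
      have h2 := S.potential_le x hx0
      have h3 : |((k : ℝ) ^ 2 - 1 / 4) / Real.sinh x ^ 2| * Real.sinh x ^ 2 =
          |(k : ℝ) ^ 2 - 1 / 4| := by
        rw [abs_div, abs_of_pos (by positivity : 0 < Real.sinh x ^ 2)]
        field_simp
      have h4 : |q x| ≤ |((k : ℝ) ^ 2 - 1 / 4) / Real.sinh x ^ 2| + |V x| := abs_add_le _ _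
      have := mul_le_mul_of_nonneg_right h4 (sq_nonneg (Real.sinh x))
      linarith
    have h5 : Real.exp x * (1 - Real.exp (-2 * r)) / 2 ≤ Real.sinh x := by
      rw [Real.sinh_eq]
      have h6 : Real.exp (-x) = Real.exp x * Real.exp (-2 * x) := by
        rw [← Real.exp_add]
        ring_nf
      have h7 : Real.exp (-2 * x) ≤ Real.exp (-2 * r) := Real.exp_le_exp.2 (by linarith)
      have := mul_le_mul_of_nonneg_left h7 (Real.exp_pos x).le
      rw [h6]
      linarith
    have hex := Real.exp_pos x
    refine h1.trans ?_
    calc A / Real.sinh x ^ 2 ≤ A / (Real.exp x * (1 - Real.exp (-2 * r)) / 2) ^ 2 := by gcongr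
      _ = _ := by
        have h8 : Real.exp (-2 * x) = (Real.exp x ^ 2)⁻¹ := by
          rw [← Real.exp_nat_mul, ← Real.exp_neg]
          congr 1
          push_cast
          ring
        rw [h8]
        field_simp
        norm_num

/-! ### Spectrum and eigenvalues -/

lemma exists_inverse_eq (g : HalfLineL2) : ∃ f : (schrodinger k V hV).domain,
    (f : HalfLineL2) = S.inverse g ∧ schrodinger k V hV f = g := by
  have hu := S.isRadialH2_radialSolution hV g
  have hae : S.inverse g =ᵐ[halfLine] conj k (S.radialSolution g) := by
    filter_upwards [S.inverse_ae_eq g, ae_restrict_mem measurableSet_Ioi] with r h hr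
    rw [h, S.conj_radialSolution g hr]
  refine ⟨⟨S.inverse g, _, hu, hae⟩, rfl, Lp.ext ?_⟩
  refine (schrodinger_ae_eq hV hu _ hae).trans ?_
  filter_upwards [S.ae_halfLineExpr_radialSolution (Lp.memLp g)] with r h
  exact h.2

variable {hV} in
lemma ae_halfLineExpr_of_eq_smul {f : (schrodinger k V hV).domain} {z : ℂ}
    (h : schrodinger k V hV f = z • (f : HalfLineL2)) :
    halfLineExpr k V (conj k (domainRep k f)) =ᵐ[halfLine]
      fun r => z * conj k (domainRep k f) r := by
  have h1 := schrodinger_ae_eq hV (domainRep_isRadialH2 k f) f (domainRep_ae_eq k f)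
  rw [h] at h1
  filter_upwards [h1, Lp.coeFn_smul z (f : HalfLineL2), domainRep_ae_eq k f] with r h1 h2 h3
  rw [← h1, h2, Pi.smul_apply, h3, smul_eq_mul]

variable {hV} in
lemma eq_zero_of_domainRep {f : (schrodinger k V hV).domain}
    (h : ∀ r, 0 < r → conj k (domainRep k f) r = 0) : (f : HalfLineL2) = 0 := by
  refine Lp.ext ?_
  filter_upwards [domainRep_ae_eq k f, Lp.coeFn_zero ℂ 2 halfLine,
    ae_restrict_mem measurableSet_Ioi] with r h1 h2 hr
  rw [h1, h2, h r hr, Pi.zero_apply]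

/-- A right inverse of an injective operator is a left inverse. -/
lemma inverse_schrodinger (f : (schrodinger k V hV).domain) :
    S.inverse (schrodinger k V hV f) = f := by
  obtain ⟨f', h1, h2⟩ := S.exists_inverse_eq hV (schrodinger k V hV f)
  have h3 : schrodinger k V hV (f' - f) = (0 : ℂ) • ((f' - f : (schrodinger k V hV).domain) :
      HalfLineL2) := by
    rw [LinearPMap.map_sub, h2, sub_self, zero_smul]
  have h4 := eq_zero_of_domainRep fun r hr => S.conj_eq_zero_of_halfLineExpr
    (domainRep_isRadialH2 k (f' - f)) (ae_halfLineExpr_of_eq_smul h3) hr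
  rw [← h1]
  exact sub_eq_zero.1 h4

/-- With `G = S.inverse`, `𝓛_V - m = (1 - m G) 𝓛_V`. As `G ≥ 0` and `m ≤ 0`, the operator `P = 1 - m
G` satisfies `re ⟨P x, x⟩ ≥ ‖x‖²`, hence is invertible, and the resolvent is `G P⁻¹`. -/
lemma mem_resolventSet (S : GroundState k V) {m : ℝ} (hm : m ≤ 0) :
    (m : ℂ) ∈ resolventSet (schrodinger k V hV) := by
  set P : HalfLineL2 →L[ℂ] HalfLineL2 := 1 - (m : ℂ) • S.inverse with hP
  have hunit : IsUnit P := by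
    refine ContinuousLinearMap.isUnit_of_forall_le_norm_inner_map P (c := 1) one_pos fun x => ?_
    have h1 := S.inverse_isPositive.re_inner_nonneg_left x
    have h2 : RCLike.re (inner ℂ (P x) x) =
        ‖x‖ ^ 2 - m * RCLike.re (inner ℂ (S.inverse x) x) := by
      rw [hP, sub_apply, smul_apply, one_apply_eq_self, inner_sub_left, inner_smul_left, map_sub,
        inner_self_eq_norm_sq]
      simp
    refine le_trans ?_ (RCLike.re_le_norm _)
    rw [h2]
    simp only [NNReal.coe_one, mul_one]
    nlinarith
  obtain ⟨Q, hQ⟩ := hunit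
  have hPQ : ∀ g, P ((Q⁻¹ : (HalfLineL2 →L[ℂ] HalfLineL2)ˣ).1 g) = g := fun g => by
    rw [← hQ, ← mul_apply_eq_comp, Units.mul_inv, one_apply_eq_self]
  have hQP : ∀ g, (Q⁻¹ : (HalfLineL2 →L[ℂ] HalfLineL2)ˣ).1 (P g) = g := fun g => by
    rw [← hQ, ← mul_apply_eq_comp, Units.inv_mul, one_apply_eq_self]
  have hPa : ∀ h, P h = h - (m : ℂ) • S.inverse h := fun h => rfl
  refine ⟨S.inverse ∘L (Q⁻¹ : (HalfLineL2 →L[ℂ] HalfLineL2)ˣ).1, fun g => ?_, fun f => ?_⟩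
  · obtain ⟨f, hf1, hf2⟩ := S.exists_inverse_eq hV
      ((Q⁻¹ : (HalfLineL2 →L[ℂ] HalfLineL2)ˣ).1 g)
    refine ⟨f, hf1, ?_⟩
    rw [hf1, hf2, ← hPa, hPQ]
  · have h1 : schrodinger k V hV f - (m : ℂ) • (f : HalfLineL2) = P (schrodinger k V hV f) := by
      rw [hPa, S.inverse_schrodinger hV]
    rw [h1, ContinuousLinearMap.comp_apply, hQP, S.inverse_schrodinger hV]

lemma not_isEigenvalue_of_quarter_le (S : GroundState k V) {m : ℝ} (hm : 1 / 4 ≤ m) :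
    ¬ IsEigenvalue (schrodinger k V hV) (m : ℂ) := by
  rintro ⟨f, hf0, hf⟩
  exact hf0 (eq_zero_of_domainRep fun r hr => S.conj_eq_zero_of_quarter_le
    (domainRep_isRadialH2 k f) hm (ae_halfLineExpr_of_eq_smul hf) hr)

/-- Applying `G` to `𝓛_V f = z f` gives `z G f = f`, so `z ⟨f, G f⟩ = ‖f‖² > 0` with `⟨f, G f⟩ ≥ 0`.
-/
lemma exists_pos_of_isEigenvalue (S : GroundState k V) {z : ℂ}
    (hz : IsEigenvalue (schrodinger k V hV) z) :
    ∃ m : ℝ, 0 < m ∧ z = (m : ℂ) := by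
  obtain ⟨f, hf0, hf⟩ := hz
  have h1 := S.inverse_schrodinger hV f
  rw [hf, map_smul] at h1
  set x : HalfLineL2 := (f : HalfLineL2) with hx
  have h2 := S.inverse_isPositive.inner_nonneg_right x
  rw [RCLike.nonneg_iff] at h2
  have h3 : z * inner ℂ x (S.inverse x) = (‖x‖ ^ 2 : ℝ) := by
    rw [← inner_smul_right, h1, inner_self_eq_norm_sq_to_K]
    push_cast
    rfl
  set ρ : ℂ := inner ℂ x (S.inverse x) with hρ
  have h4 : ρ = (ρ.re : ℂ) := Complex.ext rfl (by simpa using h2.2)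
  have h5 : 0 < ‖x‖ ^ 2 := by
    have := norm_pos_iff.2 hf0
    positivity
  have h6 : ρ.re ≠ 0 := fun h => by
    rw [h4, h] at h3
    simp only [Complex.ofReal_zero, mul_zero] at h3
    exact h5.ne (Complex.ofReal_injective (by simpa using h3))
  have h7 : 0 < ρ.re := lt_of_le_of_ne h2.1 (Ne.symm h6)
  refine ⟨‖x‖ ^ 2 / ρ.re, div_pos h5 h7, ?_⟩
  rw [Complex.ofReal_div, ← h3, eq_div_iff (Complex.ofReal_ne_zero.2 h6), ← h4]

theorem spectrum_of_groundState (S : GroundState k V) :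
    spec (schrodinger k V hV) ∩ Complex.ofReal '' Set.Iic (0 : ℝ) = ∅ ∧
    (¬ ∃ m : ℝ, 1 / 4 ≤ m ∧ IsEigenvalue (schrodinger k V hV) (m : ℂ)) ∧
    (∀ z : ℂ, IsEigenvalue (schrodinger k V hV) z →
      ∃ m : ℝ, 0 < m ∧ m < 1 / 4 ∧ z = (m : ℂ)) := by
  refine ⟨?_, ?_, fun z hz => ?_⟩
  · rw [eq_empty_iff_forall_notMem]
    rintro _ ⟨h, m, hm, rfl⟩
    exact h (S.mem_resolventSet hV hm)
  · rintro ⟨m, hm, h⟩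
    exact S.not_isEigenvalue_of_quarter_le hV hm h
  · obtain ⟨m, hm, rfl⟩ := S.exists_pos_of_isEigenvalue hV hz
    exact ⟨m, hm, lt_of_not_ge fun h => S.not_isEigenvalue_of_quarter_le hV h hz, rfl⟩

end GroundState

/-! ### The linearizations at the stationary solutions -/

/-- Powers of `tanh (r/2)` are thus eigenfunctions of `sinh r · d/dr`, which makes the verification
of the Riccati equation purely algebraic. -/
lemma hasDerivAt_tanh_half {r : ℝ} (hr : 0 < r) :
    HasDerivAt (fun r => Real.tanh (r / 2)) (Real.tanh (r / 2) / Real.sinh r) r := by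
  have hc := Real.cosh_pos (r / 2)
  have hs : 0 < Real.sinh (r / 2) := Real.sinh_pos_iff.mpr (by linarith)
  have h1 : HasDerivAt (fun r : ℝ => r / 2) (1 / 2) r := (hasDerivAt_id r).div_const 2
  have h2 : Real.sinh r = 2 * Real.sinh (r / 2) * Real.cosh (r / 2) := by
    rw [← Real.sinh_two_mul]
    ring_nf
  have h3 := (h1.sinh).div (h1.cosh) hc.ne'
  have e : (fun r => Real.tanh (r / 2)) = fun r => Real.sinh (r / 2) / Real.cosh (r / 2) := by
    funext x
    exact Real.tanh_eq_sinh_div_cosh _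
  rw [e]
  refine h3.congr_deriv ?_
  have h4 := Real.cosh_sq (r / 2)
  simp only [Real.tanh_eq_sinh_div_cosh, h2]
  field_simp
  linarith

lemma tanh_half_pos {r : ℝ} (hr : 0 < r) : 0 < Real.tanh (r / 2) := by
  rw [Real.tanh_eq_sinh_div_cosh]
  exact div_pos (Real.sinh_pos_iff.mpr (by linarith)) (Real.cosh_pos _)

lemma tanh_half_le_tanh_half {s r : ℝ} (hs : 0 < s) (hsr : s ≤ r) :
    Real.tanh (s / 2) ≤ Real.tanh (r / 2) := by
  have hmono : MonotoneOn (fun r => Real.tanh (r / 2)) (Ioi 0) := by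
    refine monotoneOn_of_hasDerivWithinAt_nonneg (convex_Ioi 0)
      (f' := fun r => Real.tanh (r / 2) / Real.sinh r)
      (fun x hx => (hasDerivAt_tanh_half hx).continuousAt.continuousWithinAt) ?_ ?_
    · intro x hx
      rw [interior_Ioi] at hx
      exact (hasDerivAt_tanh_half hx).hasDerivWithinAt
    · intro x hx
      rw [interior_Ioi] at hx
      exact (div_pos (tanh_half_pos hx) (Real.sinh_pos_iff.mpr hx)).le
  exact hmono hs (hs.trans_le hsr) hsr

lemma hasDerivAt_mul_tanh_half_pow (lam : ℝ) (m : ℕ) {r : ℝ} (hr : 0 < r) :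
    HasDerivAt (fun r => (lam * Real.tanh (r / 2)) ^ m)
      (m * (lam * Real.tanh (r / 2)) ^ m / Real.sinh r) r := by
  refine (((hasDerivAt_tanh_half hr).const_mul lam).pow m).congr_deriv ?_
  rcases m with _ | m
  · simp
  · rw [Nat.add_sub_cancel, pow_succ]
    ring

lemma sinh_eq_tanh_half (r : ℝ) :
    Real.sinh r = 2 * Real.tanh (r / 2) / (1 - Real.tanh (r / 2) ^ 2) := by
  have hc := Real.cosh_pos (r / 2)
  have h2 : Real.sinh r = 2 * Real.sinh (r / 2) * Real.cosh (r / 2) := by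
    rw [← Real.sinh_two_mul]
    ring_nf
  have h3 : 1 - Real.tanh (r / 2) ^ 2 = 1 / Real.cosh (r / 2) ^ 2 := by
    rw [Real.tanh_eq_sinh_div_cosh]
    have := Real.cosh_sq (r / 2)
    field_simp
    linarith
  rw [h3, h2, Real.tanh_eq_sinh_div_cosh]
  field_simp

lemma cosh_eq_tanh_half (r : ℝ) :
    Real.cosh r = (1 + Real.tanh (r / 2) ^ 2) / (1 - Real.tanh (r / 2) ^ 2) := by
  have hc := Real.cosh_pos (r / 2)
  have h2 : Real.cosh r = Real.cosh (r / 2) ^ 2 + Real.sinh (r / 2) ^ 2 := by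
    rw [← Real.cosh_two_mul]
    ring_nf
  have h3 : 1 - Real.tanh (r / 2) ^ 2 = 1 / Real.cosh (r / 2) ^ 2 := by
    rw [Real.tanh_eq_sinh_div_cosh]
    have := Real.cosh_sq (r / 2)
    field_simp
    linarith
  rw [h3, h2, Real.tanh_eq_sinh_div_cosh]
  field_simp

/-- For `X = (λ tanh (r/2))^n` and `n p = 2 k`, the function `tanh^k (r/2) / (1 + X)^p` is the
zero-energy solution for the potential `- 2k(2k + n) X / ((1 + X)² sinh² r)`. -/
def instanton (k n p : ℕ) (lam : ℝ) (hlam : 0 ≤ lam) (hn : 2 ≤ n) (hk : n * p = 2 * k) (V : ℝ → ℝ)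
    (hV : ∀ r, 0 < r → Real.sinh r ^ 2 * V r = -(2 * k * (2 * k + n) *
      (lam * Real.tanh (r / 2)) ^ n / (1 + (lam * Real.tanh (r / 2)) ^ n) ^ 2)) :
    GroundState k V where
  ψ r := Real.tanh (r / 2) ^ k / (1 + (lam * Real.tanh (r / 2)) ^ n) ^ p
  a r := k * (1 - (lam * Real.tanh (r / 2)) ^ n) / (1 + (lam * Real.tanh (r / 2)) ^ n)
  a' r := -(2 * k * n * (lam * Real.tanh (r / 2)) ^ n /
    ((1 + (lam * Real.tanh (r / 2)) ^ n) ^ 2 * Real.sinh r))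
  -- The summands serve, in order, `le_const`, `le_mul`, `a_sub_le` and `potential_le`.
  C := 1 + (1 + lam ^ n) ^ p + k * (1 + lam ^ n) + 2 * k * (2 * k + n) * (1 + lam ^ n)
  measurable := (measurable_tanh_half.pow_const k).div
    ((((measurable_tanh_half.const_mul lam).pow_const n).const_add 1).pow_const p)
  pos r hr := by
    have := tanh_half_pos hr
    positivity
  hasDerivAt r hr := by
    have ht := tanh_half_pos hr
    have hs : 0 < Real.sinh r := Real.sinh_pos_iff.mpr hr
    have hX : 0 ≤ (lam * Real.tanh (r / 2)) ^ n := by positivity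
    have h1 := hasDerivAt_mul_tanh_half_pow 1 k hr
    simp only [one_mul] at h1
    have h2 := ((hasDerivAt_mul_tanh_half_pow lam n hr).const_add 1).pow p
    have hX1 : 0 < 1 + (lam * Real.tanh (r / 2)) ^ n := by positivity
    refine (h1.div h2 (pow_pos hX1 p).ne').congr_deriv ?_
    have hk' : (n : ℝ) * p = 2 * k := by exact_mod_cast hk
    simp only [Pi.pow_apply]
    set X := (lam * Real.tanh (r / 2)) ^ n
    rcases p with _ | p
    · push_cast at hk' ⊢
      have : (k : ℝ) = 0 := by linarith
      simp [this]
    · rw [Nat.add_sub_cancel, pow_succ]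
      have hp : 0 < (1 + X) ^ p := by positivity
      push_cast at hk' ⊢
      field_simp
      linear_combination (-X) * hk'
  hasDerivAt_a r hr := by
    have ht := tanh_half_pos hr
    have hs : 0 < Real.sinh r := Real.sinh_pos_iff.mpr hr
    have hX : 0 ≤ (lam * Real.tanh (r / 2)) ^ n := by positivity
    have h1 := hasDerivAt_mul_tanh_half_pow lam n hr
    refine (((h1.const_sub 1).const_mul (k : ℝ)).div (h1.const_add 1)
      (by positivity)).congr_deriv ?_
    field_simp
    ring
  riccati r hr := by
    have ht := tanh_half_pos hr
    have hs : 0 < Real.sinh r := Real.sinh_pos_iff.mpr hr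
    rw [hV r hr]
    have hX : 0 ≤ (lam * Real.tanh (r / 2)) ^ n := by positivity
    set X := (lam * Real.tanh (r / 2)) ^ n
    field_simp
    ring
  a_sub_le r hr := by
    have ht := tanh_half_pos hr
    have hs : 0 < Real.sinh r := Real.sinh_pos_iff.mpr hr
    have ht1 := Real.tanh_lt_one (r / 2)
    have hX : 0 ≤ (lam * Real.tanh (r / 2)) ^ n := by positivity
    -- Here `2 ≤ n` enters: it makes `a - k cosh r`, a multiple of `X + t²` with `t = tanh (r/2)`,
    -- vanish to second order at the origin.
    have hX2 : (lam * Real.tanh (r / 2)) ^ n ≤ lam ^ n * Real.tanh (r / 2) ^ 2 := by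
      rw [mul_pow]
      exact mul_le_mul_of_nonneg_left (pow_le_pow_of_le_one ht.le ht1.le hn) (by positivity)
    have hc0 : 0 ≤ 1 + (1 + lam ^ n) ^ p + 2 * k * (2 * k + n) * (1 + lam ^ n) := by positivity
    rw [sinh_eq_tanh_half, cosh_eq_tanh_half]
    set t := Real.tanh (r / 2)
    set X := (lam * t) ^ n
    set M := lam ^ n
    have hd : 0 < 1 - t ^ 2 := by nlinarith
    have e1 : k * (1 - X) / (1 + X) - k * ((1 + t ^ 2) / (1 - t ^ 2)) =
        -(2 * k * (X + t ^ 2) / ((1 + X) * (1 - t ^ 2))) := by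
      field_simp
      ring
    rw [e1, abs_neg, abs_of_nonneg (by positivity)]
    have e2 : 2 * k * (X + t ^ 2) / ((1 + X) * (1 - t ^ 2)) * ((1 + t ^ 2) / (1 - t ^ 2)) =
        2 * k * (X + t ^ 2) * (1 + t ^ 2) / (1 + X) / (1 - t ^ 2) ^ 2 := by
      field_simp
    rw [e2, div_pow, ← mul_div_assoc]
    gcongr ?_ / _
    calc 2 * k * (X + t ^ 2) * (1 + t ^ 2) / (1 + X) ≤ 2 * k * (X + t ^ 2) * (1 + t ^ 2) :=
          div_le_self (by positivity) (by linarith)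
      _ ≤ 2 * k * (M * t ^ 2 + t ^ 2) * (1 + 1) := by
          gcongr
          exact pow_le_one₀ ht.le ht1.le
      _ ≤ _ := by nlinarith [mul_nonneg hc0 (sq_nonneg t)]
  le_mul s r hs hsr := by
    have ht := tanh_half_pos hs
    have ht1 := Real.tanh_lt_one (r / 2)
    have hsr' : Real.tanh (s / 2) ≤ Real.tanh (r / 2) := tanh_half_le_tanh_half hs hsr
    have htr := ht.trans_le hsr'
    have ht1r := Real.tanh_lt_one (r / 2)
    have hXs : 0 ≤ (lam * Real.tanh (s / 2)) ^ n := by positivity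
    have hXr : (lam * Real.tanh (r / 2)) ^ n ≤ lam ^ n := by
      rw [mul_pow]
      exact mul_le_of_le_one_right (by positivity) (pow_le_one₀ htr.le ht1r.le)
    have hXr0 : 0 ≤ (lam * Real.tanh (r / 2)) ^ n := by positivity
    calc Real.tanh (s / 2) ^ k / (1 + (lam * Real.tanh (s / 2)) ^ n) ^ p
        ≤ Real.tanh (r / 2) ^ k := (div_le_self (by positivity)
          (one_le_pow₀ (by linarith))).trans (by gcongr)
      _ = (1 + (lam * Real.tanh (r / 2)) ^ n) ^ p *
          (Real.tanh (r / 2) ^ k / (1 + (lam * Real.tanh (r / 2)) ^ n) ^ p) := by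
        field_simp
      _ ≤ _ := by
        gcongr
        have h1 : (1 + (lam * Real.tanh (r / 2)) ^ n) ^ p ≤ (1 + lam ^ n) ^ p := by gcongr
        have h2 : 0 ≤ 1 + k * (1 + lam ^ n) + 2 * k * (2 * k + n) * (1 + lam ^ n) := by positivity
        linarith
  le_const r hr := by
    have ht := tanh_half_pos hr
    have ht1 := Real.tanh_lt_one (r / 2)
    have h1 : Real.tanh (r / 2) ^ k / (1 + (lam * Real.tanh (r / 2)) ^ n) ^ p ≤ 1 := by
      have hX : 0 ≤ (lam * Real.tanh (r / 2)) ^ n := by positivity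
      exact div_le_one_of_le₀ ((pow_le_one₀ ht.le ht1.le).trans
        (one_le_pow₀ (by linarith))) (by positivity)
    have h2 : 0 ≤ (1 + lam ^ n) ^ p + k * (1 + lam ^ n) + 2 * k * (2 * k + n) * (1 + lam ^ n) := by
      positivity
    linarith
  potential_le r hr := by
    have ht := tanh_half_pos hr
    have ht1 := Real.tanh_lt_one (r / 2)
    have hs : 0 < Real.sinh r := Real.sinh_pos_iff.mpr hr
    have hX : 0 ≤ (lam * Real.tanh (r / 2)) ^ n := by positivity
    rw [← abs_of_pos (by positivity : 0 < Real.sinh r ^ 2), ← abs_mul, mul_comm, hV r hr, abs_neg,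
      abs_of_nonneg (by positivity), mul_div_assoc]
    have h1 : (lam * Real.tanh (r / 2)) ^ n / (1 + (lam * Real.tanh (r / 2)) ^ n) ^ 2 ≤ 1 := by
      rw [div_le_one (by positivity)]
      nlinarith
    have h2 : 0 ≤ (2 * k * (2 * k + n) : ℝ) := by positivity
    have h3 : 0 ≤ 1 + (1 + lam ^ n) ^ p + k * (1 + lam ^ n) + 2 * k * (2 * k + n) * lam ^ n := by
      positivity
    nlinarith
  continuousOn := by
    have hX : ContinuousOn (fun r => (lam * Real.tanh (r / 2)) ^ n) (Ioi 0) := fun r hr =>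
      (hasDerivAt_mul_tanh_half_pow lam n hr).continuousAt.continuousWithinAt
    have hX0 : ∀ r ∈ Ioi (0 : ℝ), 0 ≤ (lam * Real.tanh (r / 2)) ^ n := fun r hr => by
      have := tanh_half_pos hr
      positivity
    have hc : ContinuousOn (fun r => -(2 * k * (2 * k + n) * (lam * Real.tanh (r / 2)) ^ n /
        (1 + (lam * Real.tanh (r / 2)) ^ n) ^ 2) / Real.sinh r ^ 2) (Ioi 0) := by
      refine (((continuousOn_const.mul hX).div ((continuousOn_const.add hX).pow 2)
        fun r hr => ?_).neg).div (Real.continuous_sinh.continuousOn.pow 2) fun r hr => ?_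
      · have hX1 : 0 < 1 + (lam * Real.tanh (r / 2)) ^ n := by linarith [hX0 r hr]
        exact (pow_pos hX1 2).ne'
      · exact pow_ne_zero 2 (Real.sinh_pos_iff.mpr hr).ne'
    refine hc.congr fun r hr => ?_
    have hs : 0 < Real.sinh r := Real.sinh_pos_iff.mpr hr
    rw [eq_div_iff (pow_pos hs 2).ne', mul_comm]
    exact hV r hr

/-- With `x = (λ tanh (r/2))^k`, `cos (4 arctan x) - 1 = -8 x² / (1 + x²)²`. Thus `X = x²` and `n =
2k`, and `2k (2k + n) = 8k²`. -/
lemma sinh_sq_mul_potentialV (k : ℕ) (lam : ℝ) {r : ℝ} (hr : 0 < r) :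
    Real.sinh r ^ 2 * potentialV k lam r = -(2 * k * (2 * k + (2 * k : ℕ)) *
      (lam * Real.tanh (r / 2)) ^ (2 * k) / (1 + (lam * Real.tanh (r / 2)) ^ (2 * k)) ^ 2) := by
  have hs : 0 < Real.sinh r := Real.sinh_pos_iff.mpr hr
  have hx : (lam * Real.tanh (r / 2)) ^ (2 * k) = (lam ^ k * Real.tanh (r / 2) ^ k) ^ 2 := by
    rw [← mul_pow, ← pow_mul, mul_comm k]
  rw [hx, potentialV, harmonicMap, Real.cos_two_mul, Real.cos_two_mul, Real.cos_sq_arctan]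
  set x := lam ^ k * Real.tanh (r / 2) ^ k
  push_cast
  field_simp
  ring

/-- With `X = (λ tanh (r/2))²`, `Q = 2X / (1 + X)` and `6 Q (Q - 2) = -24 X / (1 + X)²`, where `24 =
2k (2k + n)` for `k = n = 2`. -/
lemma sinh_sq_mul_potentialW (lam : ℝ) {r : ℝ} (hr : 0 < r) :
    Real.sinh r ^ 2 * potentialW lam r = -(2 * (2 : ℕ) * (2 * (2 : ℕ) + (2 : ℕ)) *
      (lam * Real.tanh (r / 2)) ^ 2 / (1 + (lam * Real.tanh (r / 2)) ^ 2) ^ 2) := by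
  have hs : 0 < Real.sinh r := Real.sinh_pos_iff.mpr hr
  rw [mul_pow, potentialW, yangMillsMap, mul_assoc 2]
  set x := lam ^ 2 * Real.tanh (r / 2) ^ 2 with hx
  have hx0 : 0 ≤ x := by positivity
  push_cast
  field_simp
  ring

end HypGap

end

theorem proposition3p5 (lam : ℝ) (hlam : 0 ≤ lam)
    (L : HypGap.HalfLineL2 →ₗ.[ℂ] HypGap.HalfLineL2)
    (hL : (∃ k : ℕ, 1 ≤ k ∧ L = HypGap.opV k lam) ∨ L = HypGap.opW lam) :
    HypGap.spec L ∩ Complex.ofReal '' Set.Iic (0 : ℝ) = ∅ ∧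
    (¬ ∃ μ : ℝ, 1 / 4 ≤ μ ∧ HypGap.IsEigenvalue L (μ : ℂ)) ∧
    (∀ z : ℂ, HypGap.IsEigenvalue L z → ∃ μ : ℝ, 0 < μ ∧ μ < 1 / 4 ∧ z = (μ : ℂ)) := by
  rcases hL with ⟨k, hk, rfl⟩ | rfl
  · exact (HypGap.instanton k (2 * k) 1 lam hlam (by omega) (by omega) _
      fun r hr => HypGap.sinh_sq_mul_potentialV k lam hr).spectrum_of_groundState _
  · exact (HypGap.instanton 2 2 2 lam hlam le_rfl rfl _
      fun r hr => HypGap.sinh_sq_mul_potentialW lam hr).spectrum_of_groundState _
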